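/- **Theorem (General covariance-comparison bound with certified references).** *Data and loss.* Let $n\ge 1$, $d\ge 0$, let $\mathcal Z$ be a measurable space with a probability distribution $\mathcal D$, and let $\ell:\mathbb R^d\times\mathcal Z\to\mathbb R$ be a jointly measurable loss, differentiable in $w$, such that for every $w$ the variable $\ell(w,Z)$, $Z\sim\mathcal D$, is $R$-sub-Gaussian, i.e. $\mathbb E\exp\{\lambda(\ell(w,Z)-\mathbb E\,\ell(w,Z))\}\le \exp(\lambda^2R^2/2)$ for all $\lambda\in\mathbb R$. Put $L(w,s)=\frac1n\sum_{i=1}^n\ell(w,z_i)$ for $s=(z_1,\dots,z_n)$, $g(w,z)=\nabla_w\ell(w,z)$ and $\bar g(w)=\mathbb E_{Z\sim\mathcal D}[g(w,Z)]$, where $g(w,Z)$ is assumed integrable for every $w$. Let $S=(Z_1,\dots,Z_n)$ and the ghost sample $S'$ each consist of $n$ i.i.d. draws from $\mathcal D$. *SGD.* Let $T\ge 1$, $\eta_t>0$, let $W_1$ be a random vector in $\mathbb R^d$, let $\mathcal U$ be a sigma-field of auxiliary randomness (possibly trivial), and let $J_1,\dots,J_{T-1}$ be random non-empty finite minibatches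 of indices from $\{1,\dots,n\}$ (repetitions allowed). Assume that $(W_1,\mathcal U)$ is independent of $S$. For $1\le t<T$ let $$G_t=\frac1{|J_t|}\sum_{i\in J_t}g(W_t,Z_i),\qquad W_{t+1}=W_t-\eta_tG_t,$$ and for $0\le r<T$ let $\mathcal H_r=\sigma(W_1,\dots,W_{r+1},J_1,\dots,J_r,B_1,\dots,B_r,G_1,\dots,G_r)$ with $B_t=(Z_i)_{i\in J_t}$. *Virtual perturbations.* Let $\Sigma_t$ ($1\le t<T$) be random symmetric matrices, $\Sigma_t\succ0$ almost surely, with $\Sigma_t$ measurable with respect to $\mathcal H_{t-1}$. Let $\varepsilon_t\mid\mathcal H_{t-1}\sim\mathcal N(0,\Sigma_t)$, where $\varepsilon_t$ is conditionally independent, given $\mathcal H_{t-1}$, of the sample, the initialization, all minibatch indices, the auxiliary randomness and $\varepsilon_1,\dots,\varepsilon_{t-1}$; that is, the conditional law of $\varepsilon_t$ given $\sigma(S,W_1,J_1,\dots,J_{T-1},\varepsilon_1,\dots,\varepsilon_{t-1})\vee\mathcal U$ is $\mathcal N(0,\Sigma_t)$. Assume that $S'$ is independent of $\sigma(S,W_1,J_1,\dots,J_{T-1},\varepsilon_1,\dots,\varepsilon_{T-1})\vee\mathcal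 U$. Put $$\widetilde W_1=W_1,\quad \widetilde W_{t+1}=\widetilde W_t-\eta_tG_t+\varepsilon_t,\qquad \xi_t=\sum_{k=1}^{t-1}\varepsilon_k,\qquad \Sigma_{1:t}=\sum_{k=1}^{t-1}\Sigma_k .$$ *Reference covariances.* Let $\Sigma_t^{\mathrm{ref}}$ ($1\le t<T$) be random symmetric matrices that are $S$-admissible: $\Sigma_t^{\mathrm{ref}}\succ0$ almost surely and $\Sigma_t^{\mathrm{ref}}$ is measurable with respect to $\sigma(\widetilde W_1,\dots,\widetilde W_t)\vee\mathcal U$. (They are the covariances of the canonical reference kernels $\mathcal N(\widetilde W_t-\eta_t\bar g(\widetilde W_t),\Sigma_t^{\mathrm{ref}})$.) Put $\Lambda_t=(\Sigma_t^{\mathrm{ref}})^{-1}$, $\|x\|_M^2=x^\top Mx$, $\mathcal K_t=\mathcal H_{t-1}\vee\mathcal U$, $$V_t^{\mathrm{ad}}(\Lambda_t)=\mathbb E\big[\|G_t-\bar g(W_t)\|_{\Lambda_t}^2\,\big|\,\mathcal K_t\big],\qquad \Gamma_t^{\mathrm{ad}}(\Lambda_t)=\mathbb E\big[\|\bar g(W_t+\xi_t)-\bar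 g(W_t)\|_{\Lambda_t}^2\,\big|\,\mathcal K_t\big],$$ $$\mathcal C_t^{\mathrm{cov}}=\frac12\,\mathbb E\Big[\operatorname{Tr}\big((\Sigma_t^{\mathrm{ref}})^{-1}\Sigma_t\big)-d+\log\frac{\det\Sigma_t^{\mathrm{ref}}}{\det\Sigma_t}\Big].$$ *Output sensitivity.* For a sample $s$ let $$\Delta^{\mathrm{ad}}(W_T,s)=\mathbb E\big[L(W_T,s)-L(W_T+\zeta_T,s)\,\big|\,\mathcal H_{T-1}\big],\qquad \zeta_T\mid\mathcal H_{T-1}\sim\mathcal N(0,\Sigma_{1:T}),$$ with $\zeta_T$ a fresh perturbation (i.e. the integral over $\zeta_T\sim\mathcal N(0,\Sigma_{1:T})$ with $W_T$ and $\Sigma_{1:T}$ held fixed), and let $\mathcal R_\Delta^{\mathrm{ad}}=\big|\mathbb E[\Delta^{\mathrm{ad}}(W_T,S')-\Delta^{\mathrm{ad}}(W_T,S)]\big|$. Assume that all these quantities are finite: the variables $\|G_t-\bar g(W_t)\|_{\Lambda_t}^2$, $\|\bar g(W_t+\xi_t)-\bar g(W_t)\|_{\Lambda_t}^2$ and the integrand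 of $\mathcal C_t^{\mathrm{cov}}$ are integrable for $1\le t<T$, the integrals defining $\Delta^{\mathrm{ad}}(W_T,S)$ and $\Delta^{\mathrm{ad}}(W_T,S')$ converge absolutely almost surely, and $\Delta^{\mathrm{ad}}(W_T,S')-\Delta^{\mathrm{ad}}(W_T,S)$ is integrable. Then $L(W_T,S')-L(W_T,S)$ is integrable, and the expected generalization error $\operatorname{gen}(W_T,S)=\mathbb E[L(W_T,S')-L(W_T,S)]$ satisfies $$|\operatorname{gen}(W_T,S)|\le\sqrt{\frac{2R^2}{n}\sum_{t=1}^{T-1}\Big(2\eta_t^2\,\mathbb E\big[V_t^{\mathrm{ad}}(\Lambda_t)+\Gamma_t^{\mathrm{ad}}(\Lambda_t)\big]+\mathcal C_t^{\mathrm{cov}}\Big)}+\mathcal R_\Delta^{\mathrm{ad}} .$$ -/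

import Mathlib

open MeasureTheory ProbabilityTheory
open scoped NNReal

/-- The parameter space `ℝ^d` with its Euclidean structure. -/
abbrev Param (d : ℕ) : Type := EuclideanSpace ℝ (Fin d)

/-- The squared norm `‖x‖²_M = xᵀ M x`. -/
noncomputable def quadNorm {d : ℕ} (M : Matrix (Fin d) (Fin d) ℝ) (x : Param d) : ℝ :=
  x.ofLp ⬝ᵥ M.mulVec x.ofLp

/-- The conditional law of `X` given `m` is the centred Gaussian `N(0, C)`, where the covariance
`C` may be random: `P(X ∈ A | m) = N(0, C)(A)` almost surely, for every Borel set `A`. -/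
def HasCondGaussianLaw {d : ℕ} {Ω : Type*} {m0 : MeasurableSpace Ω} (P : Measure Ω)
    (m : MeasurableSpace Ω) (X : Ω → Param d) (C : Ω → Matrix (Fin d) (Fin d) ℝ) : Prop :=
  ∀ A : Set (Param d), MeasurableSet A →
    P[(X ⁻¹' A).indicator (fun _ => (1 : ℝ)) | m] =ᵐ[P]
      fun ω => (multivariateGaussian (0 : Param d) (C ω)).real A

/-- The loss function and the primitive random elements of SGD with virtual perturbations.
Times run from `1` (initial iterate) to `T` (output); updates, minibatches, learning rates,
perturbations and covariances are indexed by `1 ≤ t < T`, and the values at other indices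
are irrelevant. -/
structure VirtualSGD (d n : ℕ) (Ω 𝒵 : Type*) where
  /-- The loss `ℓ(w, z)`. -/
  loss : Param d → 𝒵 → ℝ
  /-- The output is `W_T`; there are `T - 1` updates. -/
  T : ℕ
  /-- Learning rates `η_t`. -/
  η : ℕ → ℝ
  /-- The training sample `S = (Z_1, …, Z_n)`. -/
  S : Ω → Fin n → 𝒵
  /-- The ghost sample `S'`. -/
  S' : Ω → Fin n → 𝒵
  /-- The initial iterate `W_1`. -/
  W₁ : Ω → Param d
  /-- The minibatch indices `J_t`; repeated indices (sampling with replacement) are allowed. -/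
  J : ℕ → Ω → Multiset (Fin n)
  /-- The sigma-field of the auxiliary (public or ghost) randomness. -/
  U : MeasurableSpace Ω
  /-- The virtual perturbations `ε_t`. -/
  ε : ℕ → Ω → Param d
  /-- The actual perturbation covariances `Σ_t`. -/
  cov : ℕ → Ω → Matrix (Fin d) (Fin d) ℝ
  /-- The reference covariances `Σ_t^ref`. -/
  covRef : ℕ → Ω → Matrix (Fin d) (Fin d) ℝ

namespace VirtualSGD

variable {d n : ℕ} {Ω 𝒵 : Type*}

/-- The empirical risk `L(w, s) = (1/n) ∑ i, ℓ(w, z_i)`. -/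
noncomputable def empRisk (M : VirtualSGD d n Ω 𝒵) (w : Param d) (s : Fin n → 𝒵) : ℝ :=
  (1 / (n : ℝ)) * ∑ i, M.loss w (s i)

/-- The sample gradient `g(w, z) = ∇_w ℓ(w, z)`. -/
noncomputable def grad (M : VirtualSGD d n Ω 𝒵) (w : Param d) (z : 𝒵) : Param d :=
  gradient (fun v => M.loss v z) w

/-- The population gradient `ḡ(w) = E_{Z ∼ D} g(w, Z)`. -/
noncomputable def popGrad [MeasurableSpace 𝒵] (M : VirtualSGD d n Ω 𝒵) (D : Measure 𝒵)
    (w : Param d) : Param d :=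
  ∫ z, M.grad w z ∂D

/-- The minibatch gradient `(1/|J|) ∑_{i ∈ J} g(w, z_i)`, with multiplicity. -/
noncomputable def batchGrad (M : VirtualSGD d n Ω 𝒵) (w : Param d) (s : Fin n → 𝒵)
    (J : Multiset (Fin n)) : Param d :=
  (1 / (J.card : ℝ)) • (J.map fun i => M.grad w (s i)).sum

/-- The true SGD iterates: `W_{t+1} = W_t - η_t g(W_t, B_t)`, starting at index `1`
(the value at index `0` is a dummy). -/
noncomputable def W (M : VirtualSGD d n Ω 𝒵) : ℕ → Ω → Param d
  | 0 => M.W₁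
  | 1 => M.W₁
  | t + 2 => fun ω =>
      M.W (t + 1) ω - M.η (t + 1) • M.batchGrad (M.W (t + 1) ω) (M.S ω) (M.J (t + 1) ω)

/-- The stochastic gradient `G_t = g(W_t, B_t)`. -/
noncomputable def G (M : VirtualSGD d n Ω 𝒵) (t : ℕ) (ω : Ω) : Param d :=
  M.batchGrad (M.W t ω) (M.S ω) (M.J t ω)

/-- The virtual iterates: `W̃_{t+1} = W̃_t - η_t G_t + ε_t`, `W̃_1 = W_1`. The gradients are
those of the true trajectory. -/
noncomputable def Wvirt (M : VirtualSGD d n Ω 𝒵) : ℕ → Ω → Param d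
  | 0 => M.W₁
  | 1 => M.W₁
  | t + 2 => fun ω => M.Wvirt (t + 1) ω - M.η (t + 1) • M.G (t + 1) ω + M.ε (t + 1) ω

/-- The accumulated perturbation `ξ_t = ∑_{k=1}^{t-1} ε_k`. -/
noncomputable def ξ (M : VirtualSGD d n Ω 𝒵) (t : ℕ) (ω : Ω) : Param d :=
  ∑ k ∈ Finset.Ico 1 t, M.ε k ω

/-- The accumulated covariance `Σ_{1:t} = ∑_{k=1}^{t-1} Σ_k`. -/
noncomputable def accCov (M : VirtualSGD d n Ω 𝒵) (t : ℕ) (ω : Ω) :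
    Matrix (Fin d) (Fin d) ℝ :=
  ∑ k ∈ Finset.Ico 1 t, M.cov k ω

/-- The reference precision `Λ_t = (Σ_t^ref)⁻¹`. -/
noncomputable def precRef (M : VirtualSGD d n Ω 𝒵) (t : ℕ) (ω : Ω) :
    Matrix (Fin d) (Fin d) ℝ :=
  (M.covRef t ω)⁻¹

/-- The minibatch at time `t`: the index multiset `J_t` together with the data points `Z_i`,
`i ∈ J_t`, that it selects. -/
def minibatch (M : VirtualSGD d n Ω 𝒵) (t : ℕ) (ω : Ω) :
    Σ J : Multiset (Fin n), ({i : Fin n // i ∈ J} → 𝒵) :=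
  ⟨M.J t ω, fun i => M.S ω i.1⟩

/-! ### Sigma-fields -/

/-- `σ(S)`. -/
noncomputable abbrev sigmaS [MeasurableSpace 𝒵] (M : VirtualSGD d n Ω 𝒵) : MeasurableSpace Ω :=
  MeasurableSpace.comap M.S inferInstance

/-- `σ(S')`. -/
noncomputable abbrev sigmaS' [MeasurableSpace 𝒵] (M : VirtualSGD d n Ω 𝒵) : MeasurableSpace Ω :=
  MeasurableSpace.comap M.S' inferInstance

/-- `σ(W_1)`. -/
noncomputable abbrev sigmaInit (M : VirtualSGD d n Ω 𝒵) : MeasurableSpace Ω :=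
  MeasurableSpace.comap M.W₁ inferInstance

/-- `σ(ε_1, …, ε_{t-1})`. -/
noncomputable abbrev sigmaPerturb (M : VirtualSGD d n Ω 𝒵) (t : ℕ) : MeasurableSpace Ω :=
  ⨆ s ∈ Finset.Ico 1 t, MeasurableSpace.comap (M.ε s) inferInstance

/-- The real SGD history after `r` updates,
`H_r = σ(W_1, …, W_{r+1}, J_1, …, J_r, B_1, …, B_r, G_1, …, G_r)`. -/
noncomputable abbrev hist [MeasurableSpace 𝒵] (M : VirtualSGD d n Ω 𝒵) (r : ℕ) : MeasurableSpace Ω :=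
  (⨆ s ∈ Finset.Icc 1 (r + 1), MeasurableSpace.comap (M.W s) inferInstance) ⊔
    (⨆ s ∈ Finset.Icc 1 r, MeasurableSpace.comap (M.minibatch s) inferInstance) ⊔
    (⨆ s ∈ Finset.Icc 1 r, MeasurableSpace.comap (M.G s) inferInstance)

/-- `K_t = H_{t-1} ∨ U`. -/
noncomputable abbrev histAux [MeasurableSpace 𝒵] (M : VirtualSGD d n Ω 𝒵) (t : ℕ) : MeasurableSpace Ω :=
  M.hist (t - 1) ⊔ M.U

/-- The reference-visible sigma-field `F_t^Q = σ(W̃_1, …, W̃_t) ∨ U`. -/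
noncomputable abbrev refVisible (M : VirtualSGD d n Ω 𝒵) (t : ℕ) : MeasurableSpace Ω :=
  (⨆ s ∈ Finset.Icc 1 t, MeasurableSpace.comap (M.Wvirt s) inferInstance) ⊔ M.U

/-- All randomness except that of the virtual perturbations and the ghost sample:
the sample, the initialization, all minibatch indices, and the auxiliary randomness. -/
noncomputable abbrev exogenous [MeasurableSpace 𝒵] (M : VirtualSGD d n Ω 𝒵) : MeasurableSpace Ω :=
  M.sigmaS ⊔ M.sigmaInit ⊔
    (⨆ s ∈ Finset.Ico 1 M.T, MeasurableSpace.comap (M.J s) ⊤) ⊔ M.U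

/-! ### The quantities in the bound -/

/-- `gen(W_T, S) = E[L(W_T, S') - L(W_T, S)]`. -/
noncomputable def gen [MeasurableSpace Ω] (M : VirtualSGD d n Ω 𝒵) (P : Measure Ω) : ℝ :=
  ∫ ω, (M.empRisk (M.W M.T ω) (M.S' ω) - M.empRisk (M.W M.T ω) (M.S ω)) ∂P

/-- `‖G_t - ḡ(W_t)‖²_{Λ_t}`. -/
noncomputable def deviation [MeasurableSpace 𝒵] (M : VirtualSGD d n Ω 𝒵) (D : Measure 𝒵)
    (t : ℕ) (ω : Ω) : ℝ :=
  quadNorm (M.precRef t ω) (M.G t ω - M.popGrad D (M.W t ω))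

/-- `‖ḡ(W_t + ξ_t) - ḡ(W_t)‖²_{Λ_t}`. -/
noncomputable def sensitivity [MeasurableSpace 𝒵] (M : VirtualSGD d n Ω 𝒵) (D : Measure 𝒵)
    (t : ℕ) (ω : Ω) : ℝ :=
  quadNorm (M.precRef t ω) (M.popGrad D (M.W t ω + M.ξ t ω) - M.popGrad D (M.W t ω))

/-- The gradient-deviation term `V_t^ad(Λ_t) = E[‖G_t - ḡ(W_t)‖²_{Λ_t} | K_t]`. -/
noncomputable def Vad [MeasurableSpace Ω] [MeasurableSpace 𝒵] (M : VirtualSGD d n Ω 𝒵)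
    (P : Measure Ω) (D : Measure 𝒵) (t : ℕ) : Ω → ℝ :=
  P[M.deviation D t | M.histAux t]

/-- The sensitivity term `Γ_t^ad(Λ_t) = E[‖ḡ(W_t + ξ_t) - ḡ(W_t)‖²_{Λ_t} | K_t]`. -/
noncomputable def Γad [MeasurableSpace Ω] [MeasurableSpace 𝒵] (M : VirtualSGD d n Ω 𝒵)
    (P : Measure Ω) (D : Measure 𝒵) (t : ℕ) : Ω → ℝ :=
  P[M.sensitivity D t | M.histAux t]

/-- `Tr((Σ_t^ref)⁻¹ Σ_t) - d + log (det Σ_t^ref / det Σ_t)`. -/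
noncomputable def covMismatch (M : VirtualSGD d n Ω 𝒵) (t : ℕ) (ω : Ω) : ℝ :=
  (M.precRef t ω * M.cov t ω).trace - d +
    Real.log ((M.covRef t ω).det / (M.cov t ω).det)

/-- The covariance-comparison cost `C_t^cov`. -/
noncomputable def covCost [MeasurableSpace Ω] (M : VirtualSGD d n Ω 𝒵) (P : Measure Ω)
    (t : ℕ) : ℝ :=
  (1 / 2) * ∫ ω, M.covMismatch t ω ∂P

/-- The adaptive output sensitivity `Δ^ad(W_T, s) = E[L(W_T, s) - L(W_T + ζ_T, s) | H_{T-1}]`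
for a fresh perturbation `ζ_T | H_{T-1} ∼ N(0, Σ_{1:T})`. Since `W_T` and `Σ_{1:T}` are determined
by `H_{T-1}`, it is the integral over `ζ_T` with these two held fixed; this version is defined
pointwise in `s`, so that a random sample may be substituted for `s`. -/
noncomputable def outputSens (M : VirtualSGD d n Ω 𝒵) (s : Fin n → 𝒵) (ω : Ω) : ℝ :=
  ∫ ζ, (M.empRisk (M.W M.T ω) s - M.empRisk (M.W M.T ω + ζ) s)
    ∂(multivariateGaussian (0 : Param d) (M.accCov M.T ω))

/-- The output-sensitivity penalty `R_Δ^ad = |E[Δ^ad(W_T, S') - Δ^ad(W_T, S)]|`. -/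
noncomputable def outputPenalty [MeasurableSpace Ω] (M : VirtualSGD d n Ω 𝒵)
    (P : Measure Ω) : ℝ :=
  |∫ ω, (M.outputSens (M.S' ω) ω - M.outputSens (M.S ω) ω) ∂P|

/-! ### Assumptions -/

/-- The data, loss and optimization part of the setup. -/
structure IsSGD [m0 : MeasurableSpace Ω] [MeasurableSpace 𝒵] (M : VirtualSGD d n Ω 𝒵)
    (P : Measure Ω) (D : Measure 𝒵) : Prop where
  one_le_T : 1 ≤ M.T
  η_pos : ∀ t, 1 ≤ t → t < M.T → 0 < M.η t
  measurable_loss : Measurable (Function.uncurry M.loss)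
  differentiable_loss : ∀ z, Differentiable ℝ fun w => M.loss w z
  /-- The population gradient is well defined. -/
  integrable_grad : ∀ w, Integrable (M.grad w) D
  measurable_S : Measurable M.S
  measurable_S' : Measurable M.S'
  measurable_W₁ : Measurable M.W₁
  measurable_J : ∀ t, 1 ≤ t → t < M.T → ∀ j, MeasurableSet {ω | M.J t ω = j}
  J_nonempty : ∀ t, 1 ≤ t → t < M.T → ∀ ω, M.J t ω ≠ 0
  U_le : M.U ≤ m0
  /-- `S` consists of `n` i.i.d. draws from `D`. -/
  law_S : P.map M.S = Measure.pi fun _ => D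
  /-- `S'` consists of `n` i.i.d. draws from `D`. -/
  law_S' : P.map M.S' = Measure.pi fun _ => D
  /-- The ghost sample is independent of the sample and of all other randomness. -/
  indep_S' : Indep M.sigmaS' (M.exogenous ⊔ M.sigmaPerturb M.T) P
  /-- The initialization and the auxiliary randomness are (jointly) independent of `S`. -/
  indep_init_aux : Indep (M.sigmaInit ⊔ M.U) M.sigmaS P

/-- The covariance process is predictable and a.s. positive definite, and the virtual
perturbations are conditionally Gaussian: given the sample, the initialization, all (past, current
and future) minibatch indices, the auxiliary randomness and the earlier perturbations, `ε_t` has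
law `N(0, Σ_t)`. As `Σ_t` is `H_{t-1}`-measurable, this says that `ε_t | H_{t-1} ∼ N(0, Σ_t)` and
that `ε_t` is conditionally independent of all that other randomness given `H_{t-1}`. -/
structure IsPredictablePerturbation [MeasurableSpace Ω] [MeasurableSpace 𝒵]
    (M : VirtualSGD d n Ω 𝒵) (P : Measure Ω) : Prop where
  predictable : ∀ t, 1 ≤ t → t < M.T →
    ∀ i j, Measurable[M.hist (t - 1)] fun ω => M.cov t ω i j
  posDef : ∀ t, 1 ≤ t → t < M.T → ∀ᵐ ω ∂P, (M.cov t ω).PosDef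
  measurable_ε : ∀ t, 1 ≤ t → t < M.T → Measurable (M.ε t)
  condLaw : ∀ t, 1 ≤ t → t < M.T →
    HasCondGaussianLaw P (M.exogenous ⊔ M.sigmaPerturb t) (M.ε t) (M.cov t)

/-- The reference covariances are `S`-admissible: a.s. positive definite and measurable with
respect to the reference-visible sigma-field `F_t^Q`. The canonical reference kernel
`N(W̃_t - η_t ḡ(W̃_t), Σ_t^ref)` is then an `F_t^Q`-measurable Markov kernel; its innovation is
an integration variable, hence independent of everything else by construction. -/
structure IsAdmissibleReference [MeasurableSpace Ω]
    (M : VirtualSGD d n Ω 𝒵) (P : Measure Ω) : Prop where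
  posDef : ∀ t, 1 ≤ t → t < M.T → ∀ᵐ ω ∂P, (M.covRef t ω).PosDef
  visible : ∀ t, 1 ≤ t → t < M.T →
    ∀ i j, Measurable[M.refVisible t] fun ω => M.covRef t ω i j

/-- All quantities appearing in the bound are finite. -/
structure HasFiniteQuantities [MeasurableSpace Ω] [MeasurableSpace 𝒵]
    (M : VirtualSGD d n Ω 𝒵) (P : Measure Ω) (D : Measure 𝒵) : Prop where
  deviation : ∀ t, 1 ≤ t → t < M.T → Integrable (M.deviation D t) P
  sensitivity : ∀ t, 1 ≤ t → t < M.T → Integrable (M.sensitivity D t) P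
  covMismatch : ∀ t, 1 ≤ t → t < M.T → Integrable (M.covMismatch t) P
  /-- The output sensitivity is well defined at `S` ... -/
  outputSens_S : ∀ᵐ ω ∂P,
    Integrable (fun ζ => M.empRisk (M.W M.T ω) (M.S ω) - M.empRisk (M.W M.T ω + ζ) (M.S ω))
      (multivariateGaussian (0 : Param d) (M.accCov M.T ω))
  /-- ... and at `S'` ... -/
  outputSens_S' : ∀ᵐ ω ∂P,
    Integrable (fun ζ => M.empRisk (M.W M.T ω) (M.S' ω) - M.empRisk (M.W M.T ω + ζ) (M.S' ω))
      (multivariateGaussian (0 : Param d) (M.accCov M.T ω))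
  /-- ... and the expectation defining the penalty exists. -/
  outputPenalty : Integrable (fun ω => M.outputSens (M.S' ω) ω - M.outputSens (M.S ω) ω) P

end VirtualSGD

/-! The virtual path W̃_t = W_t + ξ_t is compared with reference dynamics that never look at the
sample: given the past, W̃_{t+1} ∼ N(W̃_t - η_t ḡ(W̃_t), Σ_t^ref). Let Z be the product over the
steps of reference density over true density (`pathRatio`), and dQ = Z dP. By admissibility each
reference kernel depends only on W̃_1, …, W̃_t and 𝒰, so an induction on time
(`IsSGD.indep_refVisible`) shows that under Q the sample keeps its law D^n and is independent of the
virtual path. Hence f = L_D(W̃_T) - L(W̃_T, S), with L_D the population risk, is sub-Gaussian under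
Q with proxy R²/n, and a Donsker-Varadhan argument gives |E f| ≤ √((2R²/n) · (-E log Z)).

The relative entropy -E log Z is a sum over steps. Each step compares two Gaussians given the past:
the covariances contribute C_t^cov, the means ½ E‖η_t(ḡ(W̃_t) - G_t)‖²_Λ. Splitting the latter
difference at ḡ(W_t) bounds it by η_t² E[V_t + Γ_t], half of what the theorem allows
(`IsSGD.integrable_log_stepRatio`).

It remains to return from W̃_T to W_T. SGD itself runs unperturbed, so every Σ_t is a function of S,
W_1 and the minibatches; conditionally on the exogenous randomness ξ_T is N(0, Σ_{1:T})
(`IsSGD.lintegral_comp_ξ`). In expectation the fresh ζ_T may therefore be replaced by ξ_T, so gen is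
E[Δ(S') - Δ(S)] plus E[L(W̃_T, S') - L(W̃_T, S)]. The ghost sample is independent of W̃_T, so the
last expectation equals E f. -/

/-! ### Gaussian densities -/

section GaussianDensity

open Matrix WithLp
open scoped MatrixOrder ENNReal RealInnerProductSpace

variable {d : ℕ}

/-- The density of the centred Gaussian with covariance `C`. -/
noncomputable def gaussDens (C : Matrix (Fin d) (Fin d) ℝ) (v : Param d) : ℝ :=
  (√((2 * Real.pi) ^ d * C.det))⁻¹ * Real.exp (-(quadNorm C⁻¹ v) / 2)

theorem gaussDens_nonneg (C : Matrix (Fin d) (Fin d) ℝ) (v : Param d) : 0 ≤ gaussDens C v := by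
  unfold gaussDens; positivity

theorem gaussDens_pos {C : Matrix (Fin d) (Fin d) ℝ} (hC : C.PosDef) (v : Param d) :
    0 < gaussDens C v := by
  have := hC.det_pos
  unfold gaussDens; positivity

theorem quadNorm_one (v : Param d) : quadNorm 1 v = ‖v‖ ^ 2 := by
  rw [EuclideanSpace.real_norm_sq_eq]
  simp [quadNorm, dotProduct, sq]

instance : MeasurableSpace (Matrix (Fin d) (Fin d) ℝ) :=
  inferInstanceAs (MeasurableSpace (Fin d → Fin d → ℝ))

instance : BorelSpace (Matrix (Fin d) (Fin d) ℝ) :=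
  inferInstanceAs (BorelSpace (Fin d → Fin d → ℝ))

instance : SecondCountableTopology (Matrix (Fin d) (Fin d) ℝ) :=
  inferInstanceAs (SecondCountableTopology (Fin d → Fin d → ℝ))

theorem measurable_matrix_of_entries {α : Type*} {m : MeasurableSpace α}
    {C : α → Matrix (Fin d) (Fin d) ℝ} (h : ∀ i j, Measurable fun a => C a i j) :
    Measurable C :=
  measurable_pi_iff.2 fun i => measurable_pi_iff.2 fun j => h i j

theorem measurable_matrix_inv :
    Measurable fun C : Matrix (Fin d) (Fin d) ℝ => C⁻¹ := by
  have h : (fun C : Matrix (Fin d) (Fin d) ℝ => C⁻¹) = fun C => (C.det)⁻¹ • C.adjugate := by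
    funext C; rw [Matrix.inv_def, Ring.inverse_eq_inv']
  rw [h]
  have h1 : Measurable fun C : Matrix (Fin d) (Fin d) ℝ => C.det :=
    (continuous_id.matrix_det).measurable
  have h2 : Measurable fun C : Matrix (Fin d) (Fin d) ℝ => C.adjugate :=
    (continuous_id.matrix_adjugate).measurable
  refine measurable_matrix_of_entries fun i j => ?_
  have h3 : Measurable fun C : Matrix (Fin d) (Fin d) ℝ => C.adjugate i j :=
    (continuous_id.matrix_adjugate.matrix_elem i j).measurable
  exact h1.inv.mul h3

theorem continuous_quadNorm :
    Continuous fun p : Matrix (Fin d) (Fin d) ℝ × Param d => quadNorm p.1 p.2 := by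
  unfold quadNorm
  simp only [dotProduct, mulVec]
  fun_prop

theorem measurable_quadNorm :
    Measurable fun p : Matrix (Fin d) (Fin d) ℝ × Param d => quadNorm p.1 p.2 :=
  continuous_quadNorm.measurable

/-- Joint measurability in the covariance and the point lets random covariances enter Tonelli
arguments: Gaussian integrals are rewritten as Lebesgue integrals against this density. -/
theorem measurable_gaussDens :
    Measurable fun p : Matrix (Fin d) (Fin d) ℝ × Param d => gaussDens p.1 p.2 := by
  unfold gaussDens
  have h1 : Measurable fun C : Matrix (Fin d) (Fin d) ℝ => C.det :=
    (continuous_id.matrix_det).measurable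
  have h2 : Measurable fun p : Matrix (Fin d) (Fin d) ℝ × Param d => quadNorm p.1⁻¹ p.2 :=
    measurable_quadNorm.comp ((measurable_matrix_inv.comp measurable_fst).prodMk measurable_snd)
  have h3 : Measurable fun p : Matrix (Fin d) (Fin d) ℝ × Param d => p.1.det :=
    h1.comp measurable_fst
  refine Measurable.mul (Measurable.inv (Real.continuous_sqrt.measurable.comp
    (h3.const_mul _))) (Real.measurable_exp.comp (h2.neg.div_const 2))

/-- Both sides are finite measures with the same characteristic function, by the Gaussian Fourier
integral with b = 1/2. -/
theorem stdGaussian_eq_withDensity :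
    stdGaussian (Param d) = volume.withDensity fun v => ENNReal.ofReal (gaussDens 1 v) := by
  have hm : Measurable fun v : Param d => gaussDens 1 v :=
    measurable_gaussDens.comp (measurable_const.prodMk measurable_id)
  have hint : Integrable (fun v : Param d => gaussDens (1 : Matrix (Fin d) (Fin d) ℝ) v) := by
    have := (GaussianFourier.integrable_cexp_neg_mul_sq_norm_add (V := Param d)
      (b := (1 / 2 : ℂ)) (by norm_num) 0 0).norm
    unfold gaussDens
    refine Integrable.const_mul ?_ _
    refine this.congr (ae_of_all _ fun v => ?_)
    simp only [inv_one, quadNorm_one, Complex.norm_exp]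
    congr 1
    simp [← Complex.ofReal_pow]
    ring
  have : IsFiniteMeasure (volume.withDensity fun v : Param d =>
      ENNReal.ofReal (gaussDens (1 : Matrix (Fin d) (Fin d) ℝ) v)) :=
    isFiniteMeasure_withDensity_ofReal hint.2
  refine Measure.ext_of_charFun ?_
  ext t
  rw [charFun_stdGaussian, charFun_apply,
    integral_withDensity_eq_integral_toReal_smul hm.ennreal_ofReal (by simp)]
  have key := GaussianFourier.integral_cexp_neg_mul_sq_norm_add (V := Param d)
    (b := (1 / 2 : ℂ)) (by norm_num) Complex.I t
  have hs : (√((2 * Real.pi) ^ d) : ℂ) = ((Real.pi : ℂ) / (1 / 2)) ^ ((d : ℂ) / 2) := by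
    rw [Real.sqrt_eq_rpow, ← Real.rpow_natCast, ← Real.rpow_mul (by positivity),
      Complex.ofReal_cpow (by positivity)]
    push_cast
    congr 1 <;> ring
  have hpos : (√((2 * Real.pi) ^ d) : ℂ) ≠ 0 := by
    rw [Complex.ofReal_ne_zero]; positivity
  calc Complex.exp (-↑‖t‖ ^ 2 / 2)
      = (√((2 * Real.pi) ^ d) : ℂ)⁻¹ * ∫ v : Param d,
          Complex.exp (-(1 / 2) * ‖v‖ ^ 2 + Complex.I * ⟪t, v⟫) := by
        rw [key, finrank_euclideanSpace_fin, ← hs, ← mul_assoc, inv_mul_cancel₀ hpos, one_mul]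
        congr 1
        rw [Complex.I_sq]; ring
    _ = _ := by
        rw [← integral_const_mul]
        refine integral_congr_ae (ae_of_all _ fun v => ?_)
        simp only []
        rw [ENNReal.toReal_ofReal (gaussDens_nonneg _ _)]
        simp only [gaussDens, inv_one, quadNorm_one, det_one, mul_one, Complex.real_smul]
        push_cast
        rw [mul_assoc, ← Complex.exp_add, real_inner_comm]
        congr 2
        ring

theorem det_toEuclideanCLM (A : Matrix (Fin d) (Fin d) ℝ) :
    LinearMap.det ((toEuclideanCLM (𝕜 := ℝ) A : Param d →L[ℝ] Param d) : Param d →ₗ[ℝ] Param d)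
      = A.det := by
  rw [coe_toEuclideanCLM_eq_toEuclideanLin]
  rw [Matrix.toEuclideanLin_eq_toLin_orthonormal, LinearMap.det_toLin]

/-- N(0, C) is the image of the standard Gaussian under √C, so this is a linear change of variables,
using ‖√C x‖²_{C⁻¹} = ‖x‖² and (det √C)² = det C. -/
theorem multivariateGaussian_eq_withDensity {C : Matrix (Fin d) (Fin d) ℝ} (hC : C.PosDef) :
    multivariateGaussian (0 : Param d) C =
      volume.withDensity fun v => ENNReal.ofReal (gaussDens C v) := by
  set A := CFC.sqrt C with hA
  have hAA : A * A = C := CFC.sqrt_mul_sqrt_self _ hC.posSemidef.nonneg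
  have hApsd : A.PosSemidef := (CFC.sqrt_nonneg C).posSemidef
  have hdet : A.det * A.det = C.det := by rw [← det_mul, hAA]
  have hCpos := hC.det_pos
  have hAdet : 0 < A.det := by
    have := hApsd.det_nonneg
    rcases this.lt_or_eq with h | h
    · exact h
    · rw [← h] at hdet; simp at hdet; linarith
  have hsym : Aᵀ = A := by
    have := hApsd.isHermitian.eq
    rwa [conjTranspose_eq_transpose_of_trivial] at this
  have hu : IsUnit A.det := hAdet.ne'.isUnit
  have hquad : ∀ x : Param d, quadNorm C⁻¹ (toEuclideanCLM (𝕜 := ℝ) A x) = quadNorm 1 x := by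
    intro x
    have h1 : (toEuclideanCLM (𝕜 := ℝ) A x).ofLp = A *ᵥ x.ofLp := rfl
    unfold quadNorm
    rw [h1, ← hAA, Matrix.mul_inv_rev, mulVec_mulVec, Matrix.mul_assoc, Matrix.nonsing_inv_mul _ hu,
      Matrix.mul_one, one_mulVec, dotProduct_mulVec, vecMul_mulVec, hsym,
      Matrix.mul_nonsing_inv _ hu, vecMul_one]
  have hlin : Measurable fun x : Param d => toEuclideanCLM (𝕜 := ℝ) A x := by fun_prop
  have hg : Measurable fun v : Param d => ENNReal.ofReal (gaussDens C v) :=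
    (measurable_gaussDens.comp (measurable_const.prodMk measurable_id)).ennreal_ofReal
  have hmap : Measure.map (fun x : Param d => toEuclideanCLM (𝕜 := ℝ) A x) volume =
      ENNReal.ofReal (A.det)⁻¹ • volume := by
    have h := Measure.map_linearMap_addHaar_eq_smul_addHaar (volume : Measure (Param d))
      (f := ((toEuclideanCLM (𝕜 := ℝ) A : Param d →L[ℝ] Param d) : Param d →ₗ[ℝ] Param d))
      (by rw [det_toEuclideanCLM]; exact hAdet.ne')
    rw [det_toEuclideanCLM, abs_of_pos (inv_pos.2 hAdet)] at h
    exact h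
  have hdens : ∀ x : Param d, ENNReal.ofReal (gaussDens 1 x) =
      ENNReal.ofReal A.det * ENNReal.ofReal (gaussDens C (toEuclideanCLM (𝕜 := ℝ) A x)) := by
    intro x
    rw [← ENNReal.ofReal_mul hAdet.le]
    congr 1
    unfold gaussDens
    rw [hquad, inv_one, ← hdet, det_one, mul_one, Real.sqrt_mul (by positivity),
      Real.sqrt_mul_self hAdet.le]
    field_simp
  unfold multivariateGaussian
  simp only [zero_add]
  rw [stdGaussian_eq_withDensity, ← hA]
  ext s hs
  rw [Measure.map_apply hlin hs, withDensity_apply _ (hlin hs), withDensity_apply _ hs,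
    ← lintegral_indicator (hlin hs), ← lintegral_indicator hs]
  calc _ = ∫⁻ x : Param d, ENNReal.ofReal A.det * s.indicator
            (fun v => ENNReal.ofReal (gaussDens C v)) (toEuclideanCLM (𝕜 := ℝ) A x) := by
        refine lintegral_congr fun x => ?_
        by_cases hx : toEuclideanCLM (𝕜 := ℝ) A x ∈ s
        · rw [Set.indicator_of_mem (by exact hx), Set.indicator_of_mem hx, hdens]
        · rw [Set.indicator_of_notMem (by exact hx), Set.indicator_of_notMem hx, mul_zero]
    _ = _ := by
        rw [lintegral_const_mul' _ _ ENNReal.ofReal_ne_top,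
          ← lintegral_map (hg.indicator hs) hlin, hmap, lintegral_smul_measure, smul_eq_mul,
          ← mul_assoc, ← ENNReal.ofReal_mul hAdet.le, mul_inv_cancel₀ hAdet.ne',
          ENNReal.ofReal_one, one_mul]

/-! ### Gaussian convolution, quadratic forms and second moments -/

theorem multivariateGaussian_conv {A B : Matrix (Fin d) (Fin d) ℝ} (hA : A.PosSemidef)
    (hB : B.PosSemidef) :
    multivariateGaussian (0 : Param d) A ∗ multivariateGaussian (0 : Param d) B =
      multivariateGaussian (0 : Param d) (A + B) := by
  refine Measure.ext_of_charFun ?_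
  ext t
  rw [charFun_conv, charFun_multivariateGaussian hA, charFun_multivariateGaussian hB,
    charFun_multivariateGaussian (hA.add hB), ← Complex.exp_add]
  congr 1
  simp only [inner_zero_right, Complex.ofReal_zero, zero_mul, zero_sub, add_mulVec,
    dotProduct_add, Complex.ofReal_add]
  ring

theorem quadNorm_eq_sum (M : Matrix (Fin d) (Fin d) ℝ) (v : Param d) :
    quadNorm M v = ∑ i, ∑ j, M i j * (v i * v j) := by
  simp only [quadNorm, dotProduct, mulVec, Finset.mul_sum]
  exact Finset.sum_congr rfl fun i _ => Finset.sum_congr rfl fun j _ => by ring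

theorem quadNorm_nonneg {M : Matrix (Fin d) (Fin d) ℝ} (hM : M.PosSemidef) (v : Param d) :
    0 ≤ quadNorm M v := by
  simpa [quadNorm] using hM.dotProduct_mulVec_nonneg v.ofLp

theorem quadNorm_smul (M : Matrix (Fin d) (Fin d) ℝ) (c : ℝ) (v : Param d) :
    quadNorm M (c • v) = c ^ 2 * quadNorm M v := by
  simp only [quadNorm_eq_sum, Finset.mul_sum, PiLp.smul_apply, smul_eq_mul]
  exact Finset.sum_congr rfl fun i _ => Finset.sum_congr rfl fun j _ => by ring

theorem quadNorm_add_add_quadNorm_sub (M : Matrix (Fin d) (Fin d) ℝ) (v w : Param d) :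
    quadNorm M (v + w) + quadNorm M (v - w) = 2 * quadNorm M v + 2 * quadNorm M w := by
  simp only [quadNorm_eq_sum, Finset.mul_sum, ← Finset.sum_add_distrib, PiLp.add_apply,
    PiLp.sub_apply]
  exact Finset.sum_congr rfl fun i _ => Finset.sum_congr rfl fun j _ => by ring

/-- Parallelogram identity with the nonnegative sum term dropped. -/
theorem quadNorm_sub_le {M : Matrix (Fin d) (Fin d) ℝ} (hM : M.PosSemidef) (v w : Param d) :
    quadNorm M (v - w) ≤ 2 * (quadNorm M v + quadNorm M w) := by
  linarith [quadNorm_add_add_quadNorm_sub M v w, quadNorm_nonneg hM (v + w)]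

theorem integrable_coord_mul_coord (C : Matrix (Fin d) (Fin d) ℝ) (i j : Fin d) :
    Integrable (fun v : Param d => v i * v j) (multivariateGaussian (0 : Param d) C) := by
  have h : ∀ i : Fin d, MemLp (fun v : Param d => v i) 2 (multivariateGaussian (0 : Param d) C) :=
    fun i => (IsGaussian.memLp_dual _ (EuclideanSpace.proj i : Param d →L[ℝ] ℝ) 2 (by simp))
  exact (h i).integrable_mul (h j)

theorem integral_coord (C : Matrix (Fin d) (Fin d) ℝ) (i : Fin d) :
    ∫ v : Param d, v i ∂(multivariateGaussian (0 : Param d) C) = 0 := by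
  have := (EuclideanSpace.proj i : Param d →L[ℝ] ℝ).integral_comp_id_comm
    (μ := multivariateGaussian (0 : Param d) C) IsGaussian.integrable_id
  simpa using this

theorem integrable_coord (C : Matrix (Fin d) (Fin d) ℝ) (i : Fin d) :
    Integrable (fun v : Param d => v i) (multivariateGaussian (0 : Param d) C) :=
  (IsGaussian.memLp_dual _ (EuclideanSpace.proj i : Param d →L[ℝ] ℝ) 1 (by simp)).integrable le_rfl

theorem integral_coord_mul_coord {C : Matrix (Fin d) (Fin d) ℝ} (hC : C.PosSemidef)
    (i j : Fin d) :
    ∫ v : Param d, v i * v j ∂(multivariateGaussian (0 : Param d) C) = C i j := by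
  have h : ∀ i : Fin d, MemLp (fun v : Param d => v i) 2 (multivariateGaussian (0 : Param d) C) :=
    fun i => (IsGaussian.memLp_dual _ (EuclideanSpace.proj i : Param d →L[ℝ] ℝ) 2 (by simp))
  have := covariance_eval_multivariateGaussian (μ := (0 : Param d)) hC i j
  rw [covariance_eq_sub (h i) (h j), integral_coord, integral_coord] at this
  simpa using this

theorem integrable_and_integral_shifted_coord_mul {C : Matrix (Fin d) (Fin d) ℝ}
    (hC : C.PosSemidef) (a : Param d) (i j : Fin d) :
    Integrable (fun v : Param d => (v i + a i) * (v j + a j))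
      (multivariateGaussian (0 : Param d) C) ∧
    ∫ v : Param d, (v i + a i) * (v j + a j) ∂(multivariateGaussian (0 : Param d) C) =
      C i j + a i * a j := by
  have e : (fun v : Param d => (v i + a i) * (v j + a j)) =
      fun v => (v i * v j + a i * v j) + (v i * a j + a i * a j) := by
    funext v; ring
  have h1 := integrable_coord_mul_coord C i j
  have h2 := (integrable_coord C j).const_mul (a i)
  have h3 := (integrable_coord C i).mul_const (a j)
  have h4 : Integrable (fun _ : Param d => a i * a j) (multivariateGaussian (0 : Param d) C) :=
    integrable_const _
  have h12 : Integrable (fun v : Param d => v i * v j + a i * v j)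
    (multivariateGaussian (0 : Param d) C) := h1.add h2
  have h34 : Integrable (fun v : Param d => v i * a j + a i * a j)
    (multivariateGaussian (0 : Param d) C) := h3.add h4
  rw [e]
  refine ⟨h12.add h34, ?_⟩
  rw [integral_add h12 h34, integral_add h1 h2,
    integral_add h3 h4, integral_coord_mul_coord hC, integral_const_mul, integral_coord,
    integral_mul_const, integral_coord]
  simp

theorem integrable_quadNorm_add (M : Matrix (Fin d) (Fin d) ℝ) {C : Matrix (Fin d) (Fin d) ℝ}
    (hC : C.PosSemidef) (a : Param d) :
    Integrable (fun v => quadNorm M (v + a)) (multivariateGaussian (0 : Param d) C) := by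
  simp only [quadNorm_eq_sum, PiLp.add_apply]
  exact integrable_finsetSum _ fun i _ => integrable_finsetSum _ fun j _ =>
    (integrable_and_integral_shifted_coord_mul hC a i j).1.const_mul _

/-- Expanding in coordinates, the cross terms vanish because the law is centred, and the second
moments assemble into the trace. -/
theorem integral_quadNorm_add (M : Matrix (Fin d) (Fin d) ℝ) {C : Matrix (Fin d) (Fin d) ℝ}
    (hC : C.PosSemidef) (a : Param d) :
    ∫ v, quadNorm M (v + a) ∂(multivariateGaussian (0 : Param d) C) =
      (M * C).trace + quadNorm M a := by
  have hij : ∀ i j, Integrable (fun v : Param d => M i j * ((v i + a i) * (v j + a j)))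
      (multivariateGaussian (0 : Param d) C) := fun i j =>
    (integrable_and_integral_shifted_coord_mul hC a i j).1.const_mul _
  simp only [quadNorm_eq_sum, PiLp.add_apply]
  rw [integral_finsetSum _ fun i _ => integrable_finsetSum _ fun j _ => hij i j]
  have hsym : ∀ i j, C i j = C j i := fun i j => by
    simpa using (hC.isHermitian.apply i j).symm
  simp only [trace, diag, mul_apply, ← Finset.sum_add_distrib]
  refine Finset.sum_congr rfl fun i _ => ?_
  rw [integral_finsetSum _ fun j _ => hij i j]
  refine Finset.sum_congr rfl fun j _ => ?_
  rw [integral_const_mul, (integrable_and_integral_shifted_coord_mul hC a i j).2, hsym i j]; ring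

/-! ### Trace and log-determinant -/

/-- With B = √A, the matrix BCB is positive semidefinite and has the determinant and trace of AC.
Its eigenvalues are positive, so log λ ≤ λ - 1 can be summed over them. -/
theorem log_det_mul_le_trace_sub {A C : Matrix (Fin d) (Fin d) ℝ} (hA : A.PosDef)
    (hC : C.PosDef) : Real.log (A.det * C.det) ≤ (A * C).trace - d := by
  set B := CFC.sqrt A with hB
  have hBB : B * B = A := CFC.sqrt_mul_sqrt_self _ hA.posSemidef.nonneg
  have hBh : Bᴴ = B := (CFC.sqrt_nonneg A).posSemidef.isHermitian.eq
  have hBdet : B.det * B.det = A.det := by rw [← det_mul, hBB]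
  have hAp := hA.det_pos
  have hCp := hC.det_pos
  have hD : (B * C * B).PosSemidef := by
    have := hC.posSemidef.mul_mul_conjTranspose_same B
    rwa [hBh] at this
  have hdet : (B * C * B).det = A.det * C.det := by
    rw [det_mul, det_mul, ← hBdet]; ring
  have htr : (B * C * B).trace = (A * C).trace := by
    rw [trace_mul_comm, ← Matrix.mul_assoc, hBB]
  have hev : ∀ i, hD.isHermitian.eigenvalues i ≠ 0 := by
    intro i h
    have h1 := hD.isHermitian.det_eq_prod_eigenvalues
    rw [Finset.prod_eq_zero (Finset.mem_univ i) (by simp [h]), hdet] at h1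
    exact (mul_pos hAp hCp).ne' h1
  rw [← hdet, ← htr, hD.isHermitian.det_eq_prod_eigenvalues,
    hD.isHermitian.trace_eq_sum_eigenvalues]
  simp only [RCLike.ofReal_real_eq_id, id]
  rw [Real.log_prod fun i _ => hev i]
  calc _ ≤ ∑ i, (hD.isHermitian.eigenvalues i - 1) := by
        refine Finset.sum_le_sum fun i _ => ?_
        exact Real.log_le_sub_one_of_pos ((hD.eigenvalues_nonneg i).lt_of_ne' (hev i))
    _ = _ := by simp

/-- The trace is controlled by the Kullback-Leibler type covariance mismatch. -/
theorem trace_mul_le_mismatch {A C : Matrix (Fin d) (Fin d) ℝ} (hA : A.PosDef)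
    (hC : C.PosDef) :
    (A * C).trace ≤ 2 * ((A * C).trace - d - Real.log (A.det * C.det)) + 2 * (d * Real.log 2) := by
  -- Using A/2 in place of A spends only half of the trace; the other half is what gets bounded, at
  -- the price of d log 2 from the determinant.
  have h := log_det_mul_le_trace_sub (hA.smul (show (0 : ℝ) < 1 / 2 by norm_num)) hC
  have hAp := hA.det_pos
  have hCp := hC.det_pos
  rw [det_smul, Fintype.card_fin, mul_assoc, Real.log_mul (by positivity) (by positivity),
    Real.log_pow, one_div, Real.log_inv, smul_mul, trace_smul, smul_eq_mul] at h
  linarith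

end GaussianDensity

/-! ### Disintegration along a conditional Gaussian law -/

section Disintegration

open scoped ENNReal

variable {d : ℕ} {Ω : Type*}

theorem lintegral_multivariateGaussian {C : Matrix (Fin d) (Fin d) ℝ} (hC : C.PosDef)
    {f : Param d → ℝ≥0∞} (hf : Measurable f) :
    ∫⁻ v, f v ∂(multivariateGaussian (0 : Param d) C) =
      ∫⁻ v, ENNReal.ofReal (gaussDens C v) * f v := by
  have hm : Measurable fun v : Param d => ENNReal.ofReal (gaussDens C v) :=
    (measurable_gaussDens.comp (measurable_const.prodMk measurable_id)).ennreal_ofReal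
  rw [multivariateGaussian_eq_withDensity hC, lintegral_withDensity_eq_lintegral_mul _ hm hf]
  rfl

theorem lintegral_indicator_of_hasCondGaussianLaw {m m0 : MeasurableSpace Ω} {P : Measure Ω}
    [IsProbabilityMeasure P] (hm : m ≤ m0) {X : Ω → Param d} (hX : Measurable X)
    {C : Ω → Matrix (Fin d) (Fin d) ℝ} (hlaw : HasCondGaussianLaw P m X C) {B : Set Ω}
    (hB : MeasurableSet[m] B) {A : Set (Param d)} (hA : MeasurableSet A) :
    P (B ∩ X ⁻¹' A) = ∫⁻ ω in B, multivariateGaussian (0 : Param d) (C ω) A ∂P := by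
  have h := hlaw A hA
  have hint : Integrable (fun ω => (multivariateGaussian (0 : Param d) (C ω)).real A) P :=
    integrable_condExp.congr h
  have h1 : ∫ ω in B, (multivariateGaussian (0 : Param d) (C ω)).real A ∂P =
      P.real (B ∩ X ⁻¹' A) := by
    rw [← setIntegral_congr_ae (hm _ hB) (h.mono fun ω hω _ => hω),
      setIntegral_condExp hm ((integrable_const (1 : ℝ)).indicator (hX hA)) hB,
      setIntegral_indicator (hX hA)]
    simp
  have h2 : ∀ ω, multivariateGaussian (0 : Param d) (C ω) A =
      ENNReal.ofReal ((multivariateGaussian (0 : Param d) (C ω)).real A) := fun ω => by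
    rw [measureReal_def, ENNReal.ofReal_toReal (measure_ne_top _ _)]
  simp_rw [h2]
  rw [← ofReal_integral_eq_lintegral_ofReal hint.integrableOn (ae_of_all _ fun _ => by positivity),
    h1, measureReal_def, ENNReal.ofReal_toReal (measure_ne_top _ _)]

/-- It suffices to compare rectangles, where the claim is the defining property of conditional
probability on an `m`-measurable event. Keeping `C` in the pair makes the density a function of the
point alone. -/
theorem map_prodMk_eq_withDensity_of_hasCondGaussianLaw {m m0 : MeasurableSpace Ω} {P : Measure Ω}
    [IsProbabilityMeasure P] (hm : m ≤ m0) {X : Ω → Param d} (hX : Measurable X)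
    {C : Ω → Matrix (Fin d) (Fin d) ℝ} (hC : Measurable[m] C) (hpd : ∀ᵐ ω ∂P, (C ω).PosDef)
    (hlaw : HasCondGaussianLaw P m X C) {𝒴 : Type*} [MeasurableSpace 𝒴] {Y : Ω → 𝒴}
    (hY : Measurable[m] Y) :
    P.map (fun ω => ((Y ω, C ω), X ω)) =
      ((P.map fun ω => (Y ω, C ω)).prod volume).withDensity
        fun p => ENNReal.ofReal (gaussDens p.1.2 p.2) := by
  have hYC : Measurable[m] fun ω => (Y ω, C ω) := hY.prodMk hC
  have hYC0 : Measurable fun ω => (Y ω, C ω) := hYC.mono hm le_rfl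
  have hdm : Measurable fun p : (𝒴 × Matrix (Fin d) (Fin d) ℝ) × Param d =>
      ENNReal.ofReal (gaussDens p.1.2 p.2) :=
    (measurable_gaussDens.comp ((measurable_snd.comp measurable_fst).prodMk
      measurable_snd)).ennreal_ofReal
  have : IsProbabilityMeasure (P.map fun ω => ((Y ω, C ω), X ω)) :=
    Measure.isProbabilityMeasure_map (hYC0.prodMk hX).aemeasurable
  have : IsProbabilityMeasure (P.map fun ω => (Y ω, C ω)) :=
    Measure.isProbabilityMeasure_map hYC0.aemeasurable
  refine Measure.ext_prod fun {s t} hs ht => ?_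
  rw [Measure.map_apply (hYC0.prodMk hX) (hs.prod ht), withDensity_apply _ (hs.prod ht),
    ← Measure.prod_restrict, lintegral_prod _ hdm.aemeasurable, Measure.restrict_map hYC0 hs,
    lintegral_map hdm.lintegral_prod_right' hYC0]
  have : (fun ω => ((Y ω, C ω), X ω)) ⁻¹' s ×ˢ t =
      ((fun ω => (Y ω, C ω)) ⁻¹' s) ∩ X ⁻¹' t := rfl
  rw [this, lintegral_indicator_of_hasCondGaussianLaw hm hX hlaw (hYC hs) ht]
  refine lintegral_congr_ae (ae_restrict_of_ae (hpd.mono fun ω hω => ?_))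
  simp only []
  rw [multivariateGaussian_eq_withDensity hω, withDensity_apply _ ht]

/-- The form in which conditional Gaussianity is used later: what is known to `m` is frozen while
`X` is integrated out. -/
theorem lintegral_of_hasCondGaussianLaw {m m0 : MeasurableSpace Ω} {P : Measure Ω}
    [IsProbabilityMeasure P] (hm : m ≤ m0) {X : Ω → Param d} (hX : Measurable X)
    {C : Ω → Matrix (Fin d) (Fin d) ℝ} (hC : Measurable[m] C) (hpd : ∀ᵐ ω ∂P, (C ω).PosDef)
    (hlaw : HasCondGaussianLaw P m X C) {𝒴 : Type*} [MeasurableSpace 𝒴] {Y : Ω → 𝒴}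
    (hY : Measurable[m] Y) {f : 𝒴 × Param d → ℝ≥0∞} (hf : Measurable f) :
    ∫⁻ ω, f (Y ω, X ω) ∂P =
      ∫⁻ ω, ∫⁻ v, f (Y ω, v) ∂(multivariateGaussian (0 : Param d) (C ω)) ∂P := by
  have hYC0 : Measurable fun ω => (Y ω, C ω) := (hY.prodMk hC).mono hm le_rfl
  have hdm : Measurable fun p : (𝒴 × Matrix (Fin d) (Fin d) ℝ) × Param d =>
      ENNReal.ofReal (gaussDens p.1.2 p.2) :=
    (measurable_gaussDens.comp ((measurable_snd.comp measurable_fst).prodMk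
      measurable_snd)).ennreal_ofReal
  have hf' : Measurable fun p : (𝒴 × Matrix (Fin d) (Fin d) ℝ) × Param d => f (p.1.1, p.2) := by
    fun_prop
  have : IsProbabilityMeasure (P.map fun ω => (Y ω, C ω)) :=
    Measure.isProbabilityMeasure_map hYC0.aemeasurable
  calc ∫⁻ ω, f (Y ω, X ω) ∂P
      = ∫⁻ p, f (p.1.1, p.2) ∂(P.map fun ω => ((Y ω, C ω), X ω)) :=
        (lintegral_map hf' (hYC0.prodMk hX)).symm
    _ = ∫⁻ ω, (∫⁻ v, ENNReal.ofReal (gaussDens (C ω) v) * f (Y ω, v)) ∂P := by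
        rw [map_prodMk_eq_withDensity_of_hasCondGaussianLaw hm hX hC hpd hlaw hY,
          lintegral_withDensity_eq_lintegral_mul _ hdm hf',
          lintegral_prod _ (hdm.mul hf').aemeasurable,
          lintegral_map (hdm.mul hf').lintegral_prod_right' hYC0]
        rfl
    _ = _ := lintegral_congr_ae (hpd.mono fun ω hω => by
        exact (lintegral_multivariateGaussian hω (f := fun v => f (Y ω, v))
          (hf.comp (measurable_const.prodMk measurable_id))).symm)

/-- Independence from a join of two σ-algebras can be tested on intersections. -/
theorem indep_sup_of_forall_inter {m m₁ m₂ m0 : MeasurableSpace Ω} {P : Measure Ω}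
    [IsProbabilityMeasure P] (hm : m ≤ m0) (h₁ : m₁ ≤ m0) (h₂ : m₂ ≤ m0)
    (h : ∀ A B C, MeasurableSet[m] A → MeasurableSet[m₁] B → MeasurableSet[m₂] C →
      P (A ∩ (B ∩ C)) = P A * P (B ∩ C)) : Indep m (m₁ ⊔ m₂) P := by
  set p : Set (Set Ω) := Set.image2 (· ∩ ·) {s | MeasurableSet[m₁] s} {s | MeasurableSet[m₂] s}
  have hp : IsPiSystem p := by
    rintro _ ⟨B, hB, C, hC, rfl⟩ _ ⟨B', hB', C', hC', rfl⟩ -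
    exact ⟨B ∩ B', @MeasurableSet.inter _ m₁ _ _ hB hB', C ∩ C', @MeasurableSet.inter _ m₂ _ _ hC hC',
      Set.inter_inter_inter_comm _ _ _ _⟩
  have hgen : m₁ ⊔ m₂ = MeasurableSpace.generateFrom p := by
    refine le_antisymm (sup_le (fun s hs => ?_) (fun s hs => ?_))
      (MeasurableSpace.generateFrom_le ?_)
    · exact MeasurableSpace.measurableSet_generateFrom ⟨s, hs, Set.univ, @MeasurableSet.univ _ m₂, by simp⟩
    · exact MeasurableSpace.measurableSet_generateFrom ⟨Set.univ, @MeasurableSet.univ _ m₁, s, hs, by simp⟩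
    · rintro _ ⟨B, hB, C, hC, rfl⟩
      exact @MeasurableSet.inter _ (m₁ ⊔ m₂) _ _ ((le_sup_left : m₁ ≤ m₁ ⊔ m₂) _ hB)
        ((le_sup_right : m₂ ≤ m₁ ⊔ m₂) _ hC)
  refine IndepSets.indep (p1 := {s | MeasurableSet[m] s}) (p2 := p) hm (sup_le h₁ h₂)
    (@MeasurableSpace.isPiSystem_measurableSet _ m) hp
    (@MeasurableSpace.generateFrom_measurableSet _ m).symm hgen ?_
  rw [IndepSets_iff]
  rintro A _ hA ⟨B, hB, C, hC, rfl⟩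
  exact h A B C hA hB hC

end Disintegration

/-! ### Measurability by countable case distinction -/

section CountableCases

/-- Meant for minibatches: multisets of indices form a countable type, so measurability can be
checked with the batch fixed. -/
theorem measurable_of_countable_cases {α β ι : Type*} [Countable ι] {m : MeasurableSpace α}
    [MeasurableSpace β] {J : α → ι} (hJ : ∀ j, MeasurableSet {a | J a = j}) {f : ι → α → β}
    (hf : ∀ j, Measurable (f j)) : Measurable fun a => f (J a) a := by
  intro s hs
  have : (fun a => f (J a) a) ⁻¹' s = ⋃ j, {a | J a = j} ∩ f j ⁻¹' s := by
    ext a; simp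
  rw [this]
  exact .iUnion fun j => (hJ j).inter (hf j hs)

theorem measurable_sigma_mk {ι : Type*} {β : ι → Type*} [∀ i, MeasurableSpace (β i)] (i : ι) :
    Measurable (Sigma.mk i : β i → Sigma β) := by
  intro s hs
  exact (iInf_le (fun a => (inferInstance : MeasurableSpace (β a)).map (Sigma.mk a)) i) s hs

end CountableCases

/-! ### The true and virtual trajectories and their measurability -/

namespace VirtualSGD

open Filter Topology

variable {d n : ℕ} {Ω 𝒵 : Type*} {M : VirtualSGD d n Ω 𝒵}

theorem grad_eq_sum (M : VirtualSGD d n Ω 𝒵) (w : Param d) (z : 𝒵) :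
    M.grad w z = ∑ i, fderiv ℝ (fun v => M.loss v z) w (EuclideanSpace.single i 1) •
      EuclideanSpace.single i (1 : ℝ) := by
  unfold grad gradient
  conv_lhs => rw [← (EuclideanSpace.basisFun (Fin d) ℝ).sum_repr'
    ((InnerProductSpace.toDual ℝ (Param d)).symm (fderiv ℝ (fun v => M.loss v z) w))]
  refine Finset.sum_congr rfl fun i _ => ?_
  rw [real_inner_comm, InnerProductSpace.toDual_symm_apply, EuclideanSpace.basisFun_apply]

theorem sigmaPerturb_mono {s t : ℕ} (hst : s ≤ t) : M.sigmaPerturb s ≤ M.sigmaPerturb t :=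
  iSup₂_le fun r hr => by
    rw [Finset.mem_Ico] at hr
    exact le_iSup₂_of_le (f := fun s (_ : s ∈ Finset.Ico 1 t) =>
      MeasurableSpace.comap (M.ε s) inferInstance) r
        (Finset.mem_Ico.2 ⟨hr.1, hr.2.trans_le hst⟩) le_rfl

theorem measurable_ε_sigmaPerturb {s t : ℕ} (h1 : 1 ≤ s) (hst : s < t) :
    Measurable[M.sigmaPerturb t] (M.ε s) :=
  (comap_measurable (M.ε s)).mono (le_iSup₂_of_le (f := fun s (_ : s ∈ Finset.Ico 1 t) =>
      MeasurableSpace.comap (M.ε s) inferInstance) s (Finset.mem_Ico.2 ⟨h1, hst⟩) le_rfl) le_rfl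

theorem measurable_ξ (M : VirtualSGD d n Ω 𝒵) (t : ℕ) : Measurable[M.sigmaPerturb t] (M.ξ t) := by
  unfold ξ
  refine Finset.measurable_sum _ fun s hs => ?_
  rw [Finset.mem_Ico] at hs
  exact measurable_ε_sigmaPerturb hs.1 hs.2

/-- The virtual recursion uses the gradients of the true path, so the two paths differ only by the
accumulated noise. -/
theorem Wvirt_eq_W_add_ξ (M : VirtualSGD d n Ω 𝒵) (t : ℕ) (ω : Ω) :
    M.Wvirt (t + 1) ω = M.W (t + 1) ω + M.ξ (t + 1) ω := by
  induction t with
  | zero => simp [Wvirt, W, ξ]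
  | succ t ih =>
    have h1 : M.ξ (t + 1 + 1) ω = M.ξ (t + 1) ω + M.ε (t + 1) ω := by
      unfold ξ
      rw [Finset.sum_Ico_succ_top (by omega)]
    rw [h1]
    simp only [Wvirt, W, ih, G]
    abel

theorem Wvirt_eq_W_add_ξ' (M : VirtualSGD d n Ω 𝒵) {t : ℕ} (ht : 1 ≤ t) (ω : Ω) :
    M.Wvirt t ω = M.W t ω + M.ξ t ω := by
  obtain ⟨s, rfl⟩ := Nat.exists_eq_add_of_le' ht
  exact M.Wvirt_eq_W_add_ξ s ω

theorem Wvirt_succ (M : VirtualSGD d n Ω 𝒵) {t : ℕ} (ht : 1 ≤ t) (ω : Ω) :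
    M.Wvirt (t + 1) ω = M.Wvirt t ω - M.η t • M.G t ω + M.ε t ω := by
  obtain ⟨s, rfl⟩ := Nat.exists_eq_add_of_le' ht
  rfl

theorem measurable_Wvirt_refVisible {t : ℕ} (h1 : 1 ≤ t) :
    Measurable[M.refVisible t] (M.Wvirt t) :=
  (comap_measurable (M.Wvirt t)).mono ((le_iSup₂_of_le (f := fun s (_ : s ∈ Finset.Icc 1 t) =>
      MeasurableSpace.comap (M.Wvirt s) inferInstance) t (Finset.mem_Icc.2 ⟨h1, le_rfl⟩)
        le_rfl).trans le_sup_left) le_rfl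

theorem refVisible_succ (M : VirtualSGD d n Ω 𝒵) (t : ℕ) :
    M.refVisible (t + 1) =
      M.refVisible t ⊔ MeasurableSpace.comap (M.Wvirt (t + 1)) inferInstance := by
  have : Finset.Icc 1 (t + 1) = insert (t + 1) (Finset.Icc 1 t) := by
    ext; simp; omega
  simp only [refVisible]
  rw [this, Finset.iSup_insert]
  rw [sup_comm (MeasurableSpace.comap _ _), sup_assoc, sup_comm (MeasurableSpace.comap _ _),
    ← sup_assoc]

theorem refVisible_one (M : VirtualSGD d n Ω 𝒵) :
    M.refVisible 1 = M.sigmaInit ⊔ M.U := by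
  simp [refVisible, Wvirt]

theorem measurable_covRef [MeasurableSpace Ω] {P : Measure Ω}
    (hr : M.IsAdmissibleReference P) {t : ℕ}
    (h1 : 1 ≤ t) (ht : t < M.T) : Measurable[M.refVisible t] (M.covRef t) :=
  measurable_matrix_of_entries fun i j => hr.visible t h1 ht i j

variable [MeasurableSpace 𝒵]

/-- All randomness that precedes the virtual perturbation `ε_t`, except the ghost sample. -/
noncomputable abbrev past (M : VirtualSGD d n Ω 𝒵) (t : ℕ) : MeasurableSpace Ω :=
  M.exogenous ⊔ M.sigmaPerturb t

theorem past_mono {s t : ℕ} (hst : s ≤ t) : M.past s ≤ M.past t :=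
  sup_le_sup le_rfl (sigmaPerturb_mono hst)

theorem sigmaS_le_exogenous : M.sigmaS ≤ M.exogenous :=
  le_sup_left.trans (le_sup_left.trans le_sup_left)

theorem sigmaInit_le_exogenous : M.sigmaInit ≤ M.exogenous :=
  le_sup_right.trans (le_sup_left.trans le_sup_left)

theorem U_le_exogenous : M.U ≤ M.exogenous := le_sup_right

theorem measurableSet_J_eq {t : ℕ} (h1 : 1 ≤ t) (hT : t < M.T) (j : Multiset (Fin n)) :
    MeasurableSet[M.exogenous] {ω | M.J t ω = j} := by
  have h : MeasurableSpace.comap (M.J t) ⊤ ≤ M.exogenous :=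
    (le_iSup₂_of_le (f := fun s (_ : s ∈ Finset.Ico 1 M.T) => MeasurableSpace.comap (M.J s) ⊤) t
      (Finset.mem_Ico.2 ⟨h1, hT⟩) le_rfl).trans (le_sup_right.trans le_sup_left)
  exact h _ ⟨{j}, trivial, rfl⟩

theorem measurable_S_exogenous : Measurable[M.exogenous] M.S :=
  (comap_measurable M.S).mono sigmaS_le_exogenous le_rfl

theorem measurable_minibatch {t : ℕ} (h1 : 1 ≤ t) (ht : t < M.T) :
    Measurable[M.exogenous] (M.minibatch t) := by
  refine @measurable_of_countable_cases Ω (Σ J : Multiset (Fin n), ({i : Fin n // i ∈ J} → 𝒵)) _ _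
    M.exogenous _ (M.J t) (measurableSet_J_eq h1 ht)
    (fun j ω => ⟨j, fun i => M.S ω i.1⟩) fun j => ?_
  have h : Measurable[M.exogenous] fun ω (i : {i : Fin n // i ∈ j}) => M.S ω i.1 :=
    @measurable_pi_lambda _ _ _ M.exogenous _ _ fun i =>
      (measurable_pi_apply i.1).fun_comp measurable_S_exogenous
  exact fun s hs => h (measurable_sigma_mk j hs)

variable [m0 : MeasurableSpace Ω] {P : Measure Ω} {D : Measure 𝒵}

/-- A directional derivative is the pointwise limit of k(ℓ(w + e/k, z) - ℓ(w, z)); no continuity of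
the gradient is needed. -/
theorem IsSGD.measurable_fderiv_apply (h : M.IsSGD P D) (e : Param d) :
    Measurable fun p : Param d × 𝒵 => fderiv ℝ (fun v => M.loss v p.2) p.1 e := by
  refine measurable_of_tendsto_metrizable (f := fun (k : ℕ) (p : Param d × 𝒵) =>
    (k : ℝ) • (M.loss (p.1 + ((k : ℝ))⁻¹ • e) p.2 - M.loss p.1 p.2)) (fun k => ?_) ?_
  · have h1 : Measurable fun p : Param d × 𝒵 => M.loss p.1 p.2 := h.measurable_loss
    have h2 : Measurable fun p : Param d × 𝒵 => M.loss (p.1 + ((k : ℝ))⁻¹ • e) p.2 :=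
      h.measurable_loss.comp ((measurable_fst.add_const _).prodMk measurable_snd)
    exact (h2.sub h1).const_mul (k : ℝ)
  · rw [tendsto_pi_nhds]
    intro p
    refine ((h.differentiable_loss p.2 p.1).hasFDerivAt).lim e (c := fun k : ℕ => (k : ℝ)) ?_
    simpa using tendsto_natCast_atTop_atTop (R := ℝ)

theorem IsSGD.measurable_grad (h : M.IsSGD P D) :
    Measurable fun p : Param d × 𝒵 => M.grad p.1 p.2 := by
  simp_rw [grad_eq_sum]
  exact Finset.measurable_sum _ fun i _ => (h.measurable_fderiv_apply _).smul_const _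

theorem IsSGD.measurable_popGrad [SFinite D] (h : M.IsSGD P D) : Measurable (M.popGrad D) :=
  (h.measurable_grad.stronglyMeasurable.integral_prod_right (ν := D)).measurable

theorem IsSGD.measurable_batchGrad (h : M.IsSGD P D) (j : Multiset (Fin n)) :
    Measurable fun p : Param d × (Fin n → 𝒵) => M.batchGrad p.1 p.2 j := by
  unfold batchGrad
  refine Measurable.fun_const_smul ?_ (1 / (j.card : ℝ))
  have : ∀ j : Multiset (Fin n),
      (fun p : Param d × (Fin n → 𝒵) => (j.map fun i => M.grad p.1 (p.2 i)).sum) =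
      (j.map fun i (p : Param d × (Fin n → 𝒵)) => M.grad p.1 (p.2 i)).sum := by
    intro j
    induction j using Multiset.induction_on with
    | empty => simp; rfl
    | cons a j ih => simp only [Multiset.map_cons, Multiset.sum_cons]; rw [← ih]; rfl
  rw [this]
  refine Multiset.measurable_sum _ fun f hf => ?_
  obtain ⟨i, -, rfl⟩ := Multiset.mem_map.1 hf
  exact h.measurable_grad.comp
    (measurable_fst.prodMk ((measurable_pi_apply i).comp measurable_snd))

theorem IsSGD.exogenous_le (h : M.IsSGD P D) : M.exogenous ≤ m0 := by
  refine sup_le (sup_le (sup_le h.measurable_S.comap_le h.measurable_W₁.comap_le) ?_) h.U_le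
  refine iSup₂_le fun t ht => ?_
  rw [Finset.mem_Ico] at ht
  rintro _ ⟨s, -, rfl⟩
  have : M.J t ⁻¹' s = ⋃ j ∈ s, {ω | M.J t ω = j} := by ext; simp
  rw [this]
  exact .biUnion s.to_countable fun j _ => h.measurable_J t ht.1 ht.2 j

theorem sigmaPerturb_le (h : M.IsPredictablePerturbation P) {t : ℕ} (ht : t ≤ M.T) :
    M.sigmaPerturb t ≤ m0 :=
  iSup₂_le fun s hs => by
    rw [Finset.mem_Ico] at hs
    exact (h.measurable_ε s hs.1 (hs.2.trans_le ht)).comap_le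

theorem past_le (h : M.IsSGD P D) (hp : M.IsPredictablePerturbation P) {t : ℕ} (ht : t ≤ M.T) :
    M.past t ≤ m0 := sup_le h.exogenous_le (sigmaPerturb_le hp ht)

theorem IsSGD.measurable_batchGrad_comp (h : M.IsSGD P D) {w : Ω → Param d}
    (hw : Measurable[M.exogenous] w) {t : ℕ} (h1 : 1 ≤ t) (ht : t < M.T) :
    Measurable[M.exogenous] fun ω => M.batchGrad (w ω) (M.S ω) (M.J t ω) :=
  @measurable_of_countable_cases Ω _ _ _ M.exogenous _ (M.J t) (measurableSet_J_eq h1 ht)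
    (fun j ω => M.batchGrad (w ω) (M.S ω) j) fun j _ hs =>
      hw.prodMk measurable_S_exogenous (h.measurable_batchGrad j hs)

theorem IsSGD.measurable_W (h : M.IsSGD P D) {t : ℕ} (ht : t ≤ M.T) :
    Measurable[M.exogenous] (M.W t) := by
  have hW₁ : Measurable[M.exogenous] M.W₁ :=
    (comap_measurable M.W₁).mono sigmaInit_le_exogenous le_rfl
  induction t using Nat.strong_induction_on with
  | _ t ih =>
    match t with
    | 0 => simpa [W] using hW₁
    | 1 => simpa [W] using hW₁
    | t + 2 =>
      have h1 := ih (t + 1) (by omega) (by omega)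
      have h2 := h.measurable_batchGrad_comp h1 (t := t + 1) (by omega) (by omega)
      simp only [W]
      exact h1.sub (h2.fun_const_smul (M.η (t + 1)))

theorem IsSGD.measurable_G (h : M.IsSGD P D) {t : ℕ} (h1 : 1 ≤ t) (ht : t < M.T) :
    Measurable[M.exogenous] (M.G t) :=
  h.measurable_batchGrad_comp (h.measurable_W ht.le) h1 ht

/-- The actual iterates contain no virtual noise, so the history is a function of S, W_1 and the
minibatches. Hence all predictable covariances are known at once given the exogenous randomness. -/
theorem IsSGD.hist_le_exogenous (h : M.IsSGD P D) {t : ℕ} (ht : t < M.T) :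
    M.hist t ≤ M.exogenous := by
  refine sup_le (sup_le ?_ ?_) ?_ <;> refine iSup₂_le fun s hs => ?_ <;>
    rw [Finset.mem_Icc] at hs
  · exact (h.measurable_W (by omega)).comap_le
  · exact (measurable_minibatch hs.1 (by omega)).comap_le
  · exact (h.measurable_G hs.1 (by omega)).comap_le

theorem measurable_cov (h : M.IsSGD P D) (hp : M.IsPredictablePerturbation P) {t : ℕ}
    (h1 : 1 ≤ t) (ht : t < M.T) : Measurable[M.exogenous] (M.cov t) :=
  measurable_matrix_of_entries fun i j =>
    (hp.predictable t h1 ht i j).mono (h.hist_le_exogenous (by omega)) le_rfl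

theorem measurable_accCov (h : M.IsSGD P D) (hp : M.IsPredictablePerturbation P) {t : ℕ}
    (ht : t ≤ M.T) : Measurable[M.exogenous] (M.accCov t) := by
  refine measurable_matrix_of_entries fun i j => ?_
  simp only [accCov, Matrix.sum_apply]
  refine Finset.measurable_sum _ fun s hs => ?_
  rw [Finset.mem_Ico] at hs
  exact (hp.predictable s hs.1 (by omega) i j).mono (h.hist_le_exogenous (by omega)) le_rfl

theorem IsSGD.measurable_Wvirt (h : M.IsSGD P D) {t : ℕ} (h1 : 1 ≤ t) (ht : t ≤ M.T) :
    Measurable[M.past t] (M.Wvirt t) := by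
  rw [funext (M.Wvirt_eq_W_add_ξ' h1)]
  exact ((h.measurable_W ht).mono le_sup_left le_rfl).add
    ((M.measurable_ξ t).mono le_sup_right le_rfl)

/-- W̃_s involves only the perturbations before time s, so whatever the reference uses at time t is
settled before ε_t is drawn. -/
theorem IsSGD.refVisible_le_past (h : M.IsSGD P D) {t : ℕ} (ht : t ≤ M.T) :
    M.refVisible t ≤ M.past t := by
  refine sup_le (iSup₂_le fun s hs => ?_) (U_le_exogenous.trans le_sup_left)
  rw [Finset.mem_Icc] at hs
  exact ((h.measurable_Wvirt hs.1 (hs.2.trans ht)).mono (past_mono hs.2) le_rfl).comap_le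

end VirtualSGD

theorem Measurable.gaussDens {α : Type*} {m : MeasurableSpace α} {d : ℕ}
    {C : α → Matrix (Fin d) (Fin d) ℝ} {v : α → Param d} (hC : Measurable C) (hv : Measurable v) :
    Measurable fun a => gaussDens (C a) (v a) :=
  measurable_gaussDens.comp (hC.prodMk hv)

theorem measurable_indicator_one {α : Type*} {m : MeasurableSpace α} {A : Set α}
    (hA : MeasurableSet A) : Measurable (A.indicator (1 : α → ENNReal)) :=
  measurable_one.indicator hA

/-! ### Change of measure to the reference dynamics -/

namespace VirtualSGD

open scoped ENNReal

variable {d n : ℕ} {Ω 𝒵 : Type*} [MeasurableSpace 𝒵] {M : VirtualSGD d n Ω 𝒵}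

/-- The difference `η_t (ḡ(W̃_t) - G_t)` of the conditional means of `W̃_{t+1}` under the true and
under the reference dynamics. -/
noncomputable def meanShift (M : VirtualSGD d n Ω 𝒵) (D : Measure 𝒵) (t : ℕ) (ω : Ω) : Param d :=
  M.η t • (M.popGrad D (M.Wvirt t ω) - M.G t ω)

/-- The density of the reference kernel relative to the true kernel at the realized step `t`. -/
noncomputable def stepRatio (M : VirtualSGD d n Ω 𝒵) (D : Measure 𝒵) (t : ℕ) (ω : Ω) : ℝ :=
  gaussDens (M.covRef t ω) (M.ε t ω + M.meanShift D t ω) / gaussDens (M.cov t ω) (M.ε t ω)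

/-- The likelihood ratio of the reference dynamics along the virtual path up to time `t`. -/
noncomputable def pathRatio (M : VirtualSGD d n Ω 𝒵) (D : Measure 𝒵) (t : ℕ) (ω : Ω) : ℝ :=
  ∏ k ∈ Finset.Ico 1 t, M.stepRatio D k ω

/-- The probability that the reference kernel at time `t` assigns to `A`. -/
noncomputable def refKernel (M : VirtualSGD d n Ω 𝒵) (D : Measure 𝒵) (t : ℕ) (A : Set (Param d))
    (ω : Ω) : ℝ≥0∞ :=
  ∫⁻ u, A.indicator 1 u * ENNReal.ofReal (gaussDens (M.covRef t ω)
    (u - (M.Wvirt t ω - M.η t • M.popGrad D (M.Wvirt t ω))))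

theorem stepRatio_nonneg (D : Measure 𝒵) (t : ℕ) (ω : Ω) : 0 ≤ M.stepRatio D t ω :=
  div_nonneg (gaussDens_nonneg _ _) (gaussDens_nonneg _ _)

theorem pathRatio_nonneg (D : Measure 𝒵) (t : ℕ) (ω : Ω) : 0 ≤ M.pathRatio D t ω :=
  Finset.prod_nonneg fun k _ => stepRatio_nonneg D k ω

theorem pathRatio_succ (D : Measure 𝒵) {t : ℕ} (ht : 1 ≤ t) (ω : Ω) :
    M.pathRatio D (t + 1) ω = M.pathRatio D t ω * M.stepRatio D t ω :=
  Finset.prod_Ico_succ_top ht _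

theorem refKernel_univ {D : Measure 𝒵} {t : ℕ} {ω : Ω} (hω : (M.covRef t ω).PosDef) :
    M.refKernel D t Set.univ ω = 1 := by
  have h : IsProbabilityMeasure (multivariateGaussian (0 : Param d) (M.covRef t ω)) := inferInstance
  rw [multivariateGaussian_eq_withDensity hω] at h
  have h2 := h.measure_univ
  rw [withDensity_apply _ .univ, Measure.restrict_univ] at h2
  simp only [refKernel, Set.indicator_univ, Pi.one_apply, one_mul]
  rw [← h2]
  exact lintegral_sub_right_eq_self (fun u => ENNReal.ofReal (gaussDens (M.covRef t ω) u)) _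

variable [m0 : MeasurableSpace Ω] {P : Measure Ω} {D : Measure 𝒵} [SFinite D]

theorem IsSGD.measurable_meanShift (h : M.IsSGD P D) {t : ℕ} (h1 : 1 ≤ t) (ht : t < M.T) :
    Measurable[M.past t] (M.meanShift D t) := by
  have hW := h.measurable_Wvirt h1 ht.le
  have hG := (h.measurable_G h1 ht).mono (le_sup_left : M.exogenous ≤ M.past t) le_rfl
  have hg : Measurable[M.past t] fun ω => M.popGrad D (M.Wvirt t ω) :=
    fun s hs => hW (h.measurable_popGrad hs)
  exact (hg.sub hG).fun_const_smul (M.η t)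

theorem IsSGD.measurable_stepRatio (h : M.IsSGD P D) (hp : M.IsPredictablePerturbation P)
    (hr : M.IsAdmissibleReference P) {t : ℕ} (h1 : 1 ≤ t) (ht : t < M.T) :
    Measurable[M.past (t + 1)] (M.stepRatio D t) := by
  have hle : M.past t ≤ M.past (t + 1) := past_mono (Nat.le_succ t)
  have hε : Measurable[M.past (t + 1)] (M.ε t) :=
    (measurable_ε_sigmaPerturb h1 (Nat.lt_succ_self t)).mono le_sup_right le_rfl
  have hs : Measurable[M.past (t + 1)] (M.meanShift D t) :=
    (h.measurable_meanShift h1 ht).mono hle le_rfl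
  have hc : Measurable[M.past (t + 1)] (M.cov t) :=
    (measurable_cov h hp h1 ht).mono le_sup_left le_rfl
  have hcr : Measurable[M.past (t + 1)] (M.covRef t) :=
    (measurable_covRef hr h1 ht).mono ((h.refVisible_le_past ht.le).trans hle) le_rfl
  have h2 : Measurable[M.past (t + 1)] fun ω =>
      gaussDens (M.covRef t ω) (M.ε t ω + M.meanShift D t ω) :=
    fun s hs' => (hcr.prodMk (hε.add hs)) (measurable_gaussDens hs')
  have h3 : Measurable[M.past (t + 1)] fun ω => gaussDens (M.cov t ω) (M.ε t ω) :=
    fun s hs' => (hc.prodMk hε) (measurable_gaussDens hs')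
  exact h2.div h3

theorem IsSGD.measurable_pathRatio (h : M.IsSGD P D) (hp : M.IsPredictablePerturbation P)
    (hr : M.IsAdmissibleReference P) {t : ℕ} (ht : t ≤ M.T) :
    Measurable[M.past t] (M.pathRatio D t) := by
  refine Finset.measurable_fun_prod _ fun k hk => ?_
  rw [Finset.mem_Ico] at hk
  exact (h.measurable_stepRatio hp hr hk.1 (hk.2.trans_le ht)).mono (past_mono hk.2) le_rfl

theorem IsSGD.measurable_refKernel (h : M.IsSGD P D)
    (hr : M.IsAdmissibleReference P) {t : ℕ} (h1 : 1 ≤ t) (ht : t < M.T) {A : Set (Param d)}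
    (hA : MeasurableSet A) : Measurable[M.refVisible t] (M.refKernel D t A) := by
  have hg := h.measurable_popGrad
  have hf : Measurable fun p : (Matrix (Fin d) (Fin d) ℝ × Param d) × Param d =>
      A.indicator (1 : Param d → ℝ≥0∞) p.2 * ENNReal.ofReal (gaussDens p.1.1
        (p.2 - (p.1.2 - M.η t • M.popGrad D p.1.2))) := by
    exact ((measurable_indicator_one hA).comp measurable_snd).mul
      (Measurable.ennreal_ofReal (Measurable.gaussDens (by fun_prop) (by fun_prop)))
  have hg := hf.lintegral_prod_right' (ν := (volume : Measure (Param d)))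
  have hY : Measurable[M.refVisible t] fun ω => (M.covRef t ω, M.Wvirt t ω) :=
    (measurable_covRef hr h1 ht).prodMk (measurable_Wvirt_refVisible h1)
  exact fun s hs => hY (hg hs)

/-- Importance sampling: when ε_t is integrated against its true law N(0, Σ_t), the true density
cancels the denominator of the ratio and the reference kernel remains. -/
theorem IsSGD.lintegral_mul_stepRatio [IsProbabilityMeasure P] (h : M.IsSGD P D) (hp : M.IsPredictablePerturbation P)
    (hr : M.IsAdmissibleReference P) {t : ℕ} (h1 : 1 ≤ t) (ht : t < M.T) {A : Set (Param d)}
    (hA : MeasurableSet A) {c : Ω → ℝ≥0∞} (hc : Measurable[M.past t] c) :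
    ∫⁻ ω, c ω * (A.indicator 1 (M.Wvirt (t + 1) ω) * ENNReal.ofReal (M.stepRatio D t ω)) ∂P =
      ∫⁻ ω, c ω * M.refKernel D t A ω ∂P := by
  have hcov : Measurable[M.past t] (M.cov t) :=
    (measurable_cov h hp h1 ht).mono le_sup_left le_rfl
  have hcr : Measurable[M.past t] (M.covRef t) :=
    (measurable_covRef hr h1 ht).mono (h.refVisible_le_past ht.le) le_rfl
  have hmean : Measurable[M.past t] fun ω => M.Wvirt t ω - M.η t • M.G t ω :=
    (h.measurable_Wvirt h1 ht.le).sub (((h.measurable_G h1 ht).mono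
      (le_sup_left : M.exogenous ≤ M.past t) le_rfl).fun_const_smul (M.η t))
  have hY : Measurable[M.past t] fun ω => (c ω, (M.Wvirt t ω - M.η t • M.G t ω,
      M.meanShift D t ω), (M.cov t ω, M.covRef t ω)) :=
    hc.prodMk ((hmean.prodMk (h.measurable_meanShift h1 ht)).prodMk (hcov.prodMk hcr))
  let f : (ℝ≥0∞ × (Param d × Param d) × (Matrix (Fin d) (Fin d) ℝ × Matrix (Fin d) (Fin d) ℝ)) ×
      Param d → ℝ≥0∞ := fun p => p.1.1 * (A.indicator 1 (p.1.2.1.1 + p.2) *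
        ENNReal.ofReal (gaussDens p.1.2.2.2 (p.2 + p.1.2.1.2) / gaussDens p.1.2.2.1 p.2))
  have hf : Measurable f := by
    have i1 := (measurable_indicator_one hA).comp (g := A.indicator (1 : Param d → ℝ≥0∞))
      (f := fun p : (ℝ≥0∞ × (Param d × Param d) × (Matrix (Fin d) (Fin d) ℝ ×
        Matrix (Fin d) (Fin d) ℝ)) × Param d => p.1.2.1.1 + p.2) (by fun_prop)
    exact Measurable.mul (by fun_prop) (i1.mul (Measurable.ennreal_ofReal
        (Measurable.div (Measurable.gaussDens (by fun_prop) (by fun_prop))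
          (Measurable.gaussDens (by fun_prop) (by fun_prop)))))
  have key := lintegral_of_hasCondGaussianLaw (past_le h hp ht.le) (hp.measurable_ε t h1 ht)
    hcov (hp.posDef t h1 ht) (hp.condLaw t h1 ht) hY hf
  simp only [f] at key
  simp only [M.Wvirt_succ h1, stepRatio]
  rw [key]
  refine lintegral_congr_ae ((hp.posDef t h1 ht).mono fun ω hω => ?_)
  simp only []
  rw [lintegral_multivariateGaussian hω (f := fun v => f ((c ω, (M.Wvirt t ω - M.η t • M.G t ω,
    M.meanShift D t ω), (M.cov t ω, M.covRef t ω)), v)) (hf.comp measurable_prodMk_left)]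
  have hq : Measurable fun v : Param d => A.indicator (1 : Param d → ℝ≥0∞)
      (M.Wvirt t ω - M.η t • M.G t ω + v) *
        ENNReal.ofReal (gaussDens (M.covRef t ω) (v + M.meanShift D t ω)) := by
    exact Measurable.mul ((measurable_indicator_one hA).comp (by fun_prop))
      (Measurable.ennreal_ofReal (Measurable.gaussDens (by fun_prop) (by fun_prop)))
  calc _ = ∫⁻ v, c ω * (A.indicator (1 : Param d → ℝ≥0∞) (M.Wvirt t ω - M.η t • M.G t ω + v) *
        ENNReal.ofReal (gaussDens (M.covRef t ω) (v + M.meanShift D t ω))) := by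
        refine lintegral_congr fun v => ?_
        have hpos := gaussDens_pos hω v
        simp only [f]
        rw [mul_left_comm, mul_left_comm (ENNReal.ofReal _), ← ENNReal.ofReal_mul hpos.le,
          mul_div_cancel₀ _ hpos.ne']
    _ = c ω * M.refKernel D t A ω := by
        rw [lintegral_const_mul _ hq, refKernel]
        -- Translating by the true conditional mean W̃_t - η_t G_t makes v play the role of ε_t; the
        -- distance to the reference mean is then v plus the mean shift.
        conv_rhs => rw [← lintegral_add_left_eq_self _ (M.Wvirt t ω - M.η t • M.G t ω)]
        congr 1
        refine lintegral_congr fun v => ?_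
        congr 3
        rw [meanShift, smul_sub]
        abel

/-- Under the change of measure to the reference dynamics, the sample keeps its law and is
independent of everything that is visible to the reference. -/
theorem IsSGD.indep_refVisible [IsProbabilityMeasure P] (h : M.IsSGD P D) (hp : M.IsPredictablePerturbation P)
    (hr : M.IsAdmissibleReference P) {t : ℕ} (h1 : 1 ≤ t) (ht : t ≤ M.T) :
    IsProbabilityMeasure (P.withDensity fun ω => ENNReal.ofReal (M.pathRatio D t ω)) ∧
    (∀ A, MeasurableSet[M.sigmaS] A →
      P.withDensity (fun ω => ENNReal.ofReal (M.pathRatio D t ω)) A = P A) ∧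
    Indep M.sigmaS (M.refVisible t)
      (P.withDensity fun ω => ENNReal.ofReal (M.pathRatio D t ω)) := by
  induction t, h1 using Nat.le_induction with
  | base =>
    -- At time 1 the product is empty, and the claim is the assumed independence of (W_1, 𝒰) and S.
    have : (P.withDensity fun ω => ENNReal.ofReal (M.pathRatio D 1 ω)) = P := by
      simp only [pathRatio, Finset.Ico_self, Finset.prod_empty, ENNReal.ofReal_one]
      exact withDensity_one
    rw [this]
    refine ⟨inferInstance, fun _ _ => rfl, ?_⟩
    rw [refVisible_one]
    exact h.indep_init_aux.symm
  | succ t h1 ih =>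
    have ht' : t < M.T := ht
    obtain ⟨hprob, hmarg, hind⟩ := ih ht'.le
    set Q := P.withDensity fun ω => ENNReal.ofReal (M.pathRatio D t ω) with hQ
    set Q' := P.withDensity fun ω => ENNReal.ofReal (M.pathRatio D (t + 1) ω) with hQ'
    have hpast : M.past t ≤ m0 := past_le h hp ht'.le
    have hvis : M.refVisible t ≤ M.past t := h.refVisible_le_past ht'.le
    have hS : M.sigmaS ≤ M.past t := sigmaS_le_exogenous.trans le_sup_left
    have hLm : Measurable[M.past t] fun ω => ENNReal.ofReal (M.pathRatio D t ω) :=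
      (h.measurable_pathRatio hp hr ht'.le).ennreal_ofReal
    have hWm : Measurable (M.Wvirt (t + 1)) :=
      (h.measurable_Wvirt (by omega) ht).mono (past_le h hp ht) le_rfl
    have hkm : ∀ {C}, MeasurableSet C → Measurable[M.refVisible t] (M.refKernel D t C) :=
      fun hC => h.measurable_refKernel hr h1 ht' hC
    -- Under the new measure, W̃_{t+1} given the whole past (sample included) follows the reference
    -- kernel.
    have step : ∀ A C, MeasurableSet[M.past t] A → MeasurableSet C →
        Q' (A ∩ M.Wvirt (t + 1) ⁻¹' C) = ∫⁻ ω, A.indicator 1 ω * M.refKernel D t C ω ∂Q := by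
      intro A C hA hC
      have hAm : Measurable[M.past t] (A.indicator (1 : Ω → ℝ≥0∞)) :=
        measurable_indicator_one hA
      have hkm' : Measurable (M.refKernel D t C) := (hkm hC).mono (hvis.trans hpast) le_rfl
      have hset : MeasurableSet (A ∩ M.Wvirt (t + 1) ⁻¹' C) := (hpast _ hA).inter (hWm hC)
      rw [hQ, lintegral_withDensity_eq_lintegral_mul _ (hLm.mono hpast le_rfl)
        ((hAm.mono hpast le_rfl).fun_mul hkm'), hQ', withDensity_apply _ hset,
        ← lintegral_indicator hset]
      have := h.lintegral_mul_stepRatio hp hr h1 ht' hC (hLm.mul hAm)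
      simp only [Pi.mul_apply] at this ⊢
      rw [← lintegral_congr fun ω => mul_assoc _ _ _, ← this]
      refine lintegral_congr fun ω => ?_
      have hsucc : ENNReal.ofReal (M.pathRatio D (t + 1) ω) =
          ENNReal.ofReal (M.pathRatio D t ω) * ENNReal.ofReal (M.stepRatio D t ω) := by
        rw [pathRatio_succ D h1, ENNReal.ofReal_mul (pathRatio_nonneg _ _ _)]
      by_cases hωA : ω ∈ A <;> by_cases hωC : M.Wvirt (t + 1) ω ∈ C <;>
        simp [Set.indicator, hωA, hωC, hsucc]
    have hprob' : IsProbabilityMeasure Q' := by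
      constructor
      have h2 := step Set.univ Set.univ (@MeasurableSet.univ _ (M.past t)) .univ
      rw [Set.univ_inter, Set.preimage_univ] at h2
      rw [h2, ← hprob.measure_univ, ← lintegral_one]
      refine lintegral_congr_ae ((withDensity_absolutelyContinuous _ _).ae_le
        ((hr.posDef t h1 ht').mono fun ω hω => ?_))
      simp [refKernel_univ hω]
    -- The reference kernel is a function of the visible σ-field, so the independence known at time
    -- t splits off the sample event.
    have hfac : ∀ A B C, MeasurableSet[M.sigmaS] A → MeasurableSet[M.refVisible t] B →
        MeasurableSet C → Q' (A ∩ (B ∩ M.Wvirt (t + 1) ⁻¹' C)) =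
          P A * Q' (B ∩ M.Wvirt (t + 1) ⁻¹' C) := by
      intro A B C hA hB hC
      have hAm : Measurable[M.sigmaS] (A.indicator (1 : Ω → ℝ≥0∞)) :=
        measurable_indicator_one hA
      have hBm : Measurable[M.refVisible t] (B.indicator (1 : Ω → ℝ≥0∞)) :=
        measurable_indicator_one hB
      rw [← Set.inter_assoc, step _ _ (@MeasurableSet.inter _ (M.past t) _ _ (hS _ hA) (hvis _ hB))
        hC, step _ _ (hvis _ hB) hC, ← hmarg A hA]
      have hmul := lintegral_mul_eq_lintegral_mul_lintegral_of_independent_measurableSpace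
        (hS.trans hpast) (hvis.trans hpast) hind hAm (hBm.mul (hkm hC))
      rw [lintegral_indicator_one (hpast _ (hS _ hA))] at hmul
      simp only [Pi.mul_apply] at hmul
      rw [← hmul]
      refine lintegral_congr fun ω => ?_
      rw [← mul_assoc]
      congr 1
      by_cases hωA : ω ∈ A <;> by_cases hωB : ω ∈ B <;> simp [Set.indicator, hωA, hωB]
    have hmarg' : ∀ A, MeasurableSet[M.sigmaS] A → Q' A = P A := fun A hA => by
      have := hfac A Set.univ Set.univ hA (@MeasurableSet.univ _ (M.refVisible t)) .univ
      simpa using this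
    refine ⟨hprob', hmarg', ?_⟩
    rw [refVisible_succ]
    refine indep_sup_of_forall_inter (hS.trans hpast) (hvis.trans hpast) hWm.comap_le ?_
    rintro A B _ hA hB ⟨C, hC, rfl⟩
    rw [hmarg' A hA]
    exact hfac A B C hA hB hC

end VirtualSGD

/-! ### A Donsker-Varadhan inequality -/

section DonskerVaradhan

/-- A Donsker-Varadhan type bound: if `f` is sub-Gaussian with variance proxy `σ` after a change
of measure with density `Z`, then its mean is controlled by the relative entropy `-E[log Z]`. -/
theorem integrable_and_abs_integral_le_of_change_of_measure {Ω : Type*} [MeasurableSpace Ω]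
    {P : Measure Ω} [IsProbabilityMeasure P] {f Z : Ω → ℝ} (hf : Measurable f) (hZ : Measurable Z)
    (hpos : ∀ᵐ ω ∂P, 0 < Z ω) (hlog : Integrable (fun ω => Real.log (Z ω)) P) {σ : ℝ}
    (hexp : ∀ l : ℝ, ∫⁻ ω, ENNReal.ofReal (Real.exp (l * f ω) * Z ω) ∂P ≤
      ENNReal.ofReal (Real.exp (l ^ 2 * σ / 2))) :
    Integrable f P ∧ |∫ ω, f ω ∂P| ≤ √(2 * σ * -∫ ω, Real.log (Z ω) ∂P) := by
  have hnn : ∀ l : ℝ, 0 ≤ᵐ[P] fun ω => Real.exp (l * f ω) * Z ω := fun l =>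
    hpos.mono fun ω h => by positivity
  have hint : ∀ l : ℝ, Integrable (fun ω => Real.exp (l * f ω) * Z ω) P := fun l => by
    refine ⟨((hf.const_mul l).exp.mul hZ).aestronglyMeasurable, ?_⟩
    rw [hasFiniteIntegral_iff_ofReal (hnn l)]
    exact (hexp l).trans_lt ENNReal.ofReal_lt_top
  have hle : ∀ l : ℝ, ∫ ω, Real.exp (l * f ω) * Z ω ∂P ≤ Real.exp (l ^ 2 * σ / 2) := fun l => by
    rw [integral_eq_lintegral_of_nonneg_ae (hnn l) (hint l).1]
    exact ENNReal.toReal_le_of_le_ofReal (Real.exp_pos _).le (hexp l)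
  -- From 1 + x ≤ e^x at x = ±f + log Z one gets |f| ≤ e^f Z + e^{-f} Z - log Z, which is
  -- integrable.
  have hfint : Integrable f P := by
    refine (((hint 1).add (hint (-1))).sub hlog).mono' hf.aestronglyMeasurable
      (hpos.mono fun ω hω => ?_)
    simp only [Pi.add_apply, Pi.sub_apply, one_mul, neg_mul]
    have h1 := Real.add_one_le_exp (f ω + Real.log (Z ω))
    have h2 := Real.add_one_le_exp (-f ω + Real.log (Z ω))
    rw [Real.exp_add, Real.exp_log hω] at h1 h2
    have h3 : 0 < Real.exp (f ω) * Z ω := by positivity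
    have h4 : 0 < Real.exp (-f ω) * Z ω := by positivity
    rw [Real.norm_eq_abs, abs_le]
    constructor <;> linarith
  refine ⟨hfint, Real.abs_le_sqrt ?_⟩
  -- Integrating 1 + x ≤ e^x at x = l f + log Z - l²σ/2 gives a quadratic in l that is never
  -- negative. Its discriminant condition is the bound, including the degenerate case σ = 0.
  have hquad : ∀ l : ℝ, 0 ≤ σ / 2 * (l * l) + -(∫ ω, f ω ∂P) * l +
      -∫ ω, Real.log (Z ω) ∂P := fun l => by
    have h1 : ∫ ω, (l * f ω + Real.log (Z ω) + (1 - l ^ 2 * σ / 2)) ∂P ≤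
        ∫ ω, Real.exp (-(l ^ 2 * σ / 2)) * (Real.exp (l * f ω) * Z ω) ∂P := by
      refine integral_mono_ae (((hfint.const_mul l).add hlog).add (integrable_const _))
        ((hint l).const_mul _) (hpos.mono fun ω hω => ?_)
      have h := Real.add_one_le_exp (-(l ^ 2 * σ / 2) + (l * f ω + Real.log (Z ω)))
      rw [Real.exp_add, Real.exp_add, Real.exp_log hω] at h
      simp only []
      linarith
    have h2 : Real.exp (-(l ^ 2 * σ / 2)) * ∫ ω, Real.exp (l * f ω) * Z ω ∂P ≤ 1 := by
      calc _ ≤ Real.exp (-(l ^ 2 * σ / 2)) * Real.exp (l ^ 2 * σ / 2) :=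
            mul_le_mul_of_nonneg_left (hle l) (Real.exp_pos _).le
        _ = 1 := by rw [← Real.exp_add]; simp
    have hlf : Integrable (fun ω => l * f ω) P := hfint.const_mul l
    have hsum : Integrable (fun ω => l * f ω + Real.log (Z ω)) P := hlf.add hlog
    rw [integral_const_mul, integral_add hsum (integrable_const _), integral_add hlf hlog,
      integral_const_mul] at h1
    simp only [integral_const, probReal_univ, one_smul] at h1
    nlinarith
  have := discrim_le_zero hquad
  unfold discrim at this
  nlinarith

end DonskerVaradhan

/-! ### Sub-Gaussian concentration under the reference measure -/

namespace VirtualSGD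

open scoped ENNReal

variable {d n : ℕ} {Ω 𝒵 : Type*} [MeasurableSpace 𝒵] {M : VirtualSGD d n Ω 𝒵}

/-- The population risk. -/
noncomputable def popRisk (M : VirtualSGD d n Ω 𝒵) (D : Measure 𝒵) (w : Param d) : ℝ :=
  ∫ z, M.loss w z ∂D

/-- The exponential factorizes over the i.i.d. coordinates: n factors with parameter -l/n give n ·
R²(l/n)²/2 = l²R²/(2n). -/
theorem lintegral_exp_popRisk_sub_empRisk_le {D : Measure 𝒵} [IsProbabilityMeasure D] (hn : 0 < n) {R : ℝ≥0}
    {w : Param d}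
    (hsubG : HasSubgaussianMGF (fun z => M.loss w z - ∫ z', M.loss w z' ∂D) (R ^ 2) D) (l : ℝ) :
    ∫⁻ s : Fin n → 𝒵, ENNReal.ofReal (Real.exp (l * (M.popRisk D w - M.empRisk w s)))
      ∂(Measure.pi fun _ => D) ≤ ENNReal.ofReal (Real.exp (l ^ 2 * ((R : ℝ) ^ 2 / n) / 2)) := by
  have hn' : (n : ℝ) ≠ 0 := by positivity
  have e : ∀ s : Fin n → 𝒵, Real.exp (l * (M.popRisk D w - M.empRisk w s)) =
      ∏ i, Real.exp (-(l / n) * (M.loss w (s i) - ∫ z', M.loss w z' ∂D)) := by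
    intro s
    rw [← Real.exp_sum, ← Finset.mul_sum, Finset.sum_sub_distrib, Finset.sum_const,
      Finset.card_univ, Fintype.card_fin, nsmul_eq_mul, empRisk, popRisk]
    congr 1
    field_simp
    ring
  simp_rw [e]
  have hint : Integrable (fun s : Fin n → 𝒵 =>
      ∏ i, Real.exp (-(l / n) * (M.loss w (s i) - ∫ z', M.loss w z' ∂D)))
      (Measure.pi fun _ => D) :=
    Integrable.fintype_prod (f := fun (_ : Fin n) (z : 𝒵) =>
      Real.exp (-(l / n) * (M.loss w z - ∫ z', M.loss w z' ∂D)))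
      fun _ => hsubG.integrable_exp_mul _
  rw [← ofReal_integral_eq_lintegral_ofReal hint (ae_of_all _ fun s => by positivity)]
  refine ENNReal.ofReal_le_ofReal ?_
  rw [integral_fintype_prod_eq_pow (ι := Fin n)
    (fun z => Real.exp (-(l / n) * (M.loss w z - ∫ z', M.loss w z' ∂D))), Fintype.card_fin]
  calc _ ≤ (Real.exp ((R ^ 2 : ℝ≥0) * (-(l / n)) ^ 2 / 2)) ^ n :=
        pow_le_pow_left₀ (integral_nonneg fun _ => (Real.exp_pos _).le) (hsubG.mgf_le _) n
    _ = _ := by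
        rw [← Real.exp_nat_mul]
        push_cast
        congr 1
        field_simp

variable [m0 : MeasurableSpace Ω] {P : Measure Ω} {D : Measure 𝒵}

theorem IsSGD.measurable_empRisk (h : M.IsSGD P D) :
    Measurable fun p : Param d × (Fin n → 𝒵) => M.empRisk p.1 p.2 := by
  unfold empRisk
  refine Measurable.const_mul (Finset.measurable_sum _ fun i _ => ?_) _
  exact h.measurable_loss.comp
    (measurable_fst.prodMk ((measurable_pi_apply i).comp measurable_snd))

theorem IsSGD.measurable_popRisk [SFinite D] (h : M.IsSGD P D) : Measurable (M.popRisk D) :=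
  (h.measurable_loss.stronglyMeasurable.integral_prod_right (ν := D)).measurable

/-- Under the reference measure W̃_T and S are independent with S ∼ D^n, so the bound for a fixed
parameter, uniform in w, can be integrated over W̃_T. -/
theorem IsSGD.lintegral_exp_mul_pathRatio_le [IsProbabilityMeasure P] [IsProbabilityMeasure D]
    (hn : 0 < n) {R : ℝ≥0} (h : M.IsSGD P D) (hp : M.IsPredictablePerturbation P)
    (hr : M.IsAdmissibleReference P)
    (hsubG : ∀ w, HasSubgaussianMGF (fun z => M.loss w z - ∫ z', M.loss w z' ∂D) (R ^ 2) D)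
    (l : ℝ) :
    ∫⁻ ω, ENNReal.ofReal (Real.exp (l * (M.popRisk D (M.Wvirt M.T ω) -
      M.empRisk (M.Wvirt M.T ω) (M.S ω))) * M.pathRatio D M.T ω) ∂P ≤
      ENNReal.ofReal (Real.exp (l ^ 2 * ((R : ℝ) ^ 2 / n) / 2)) := by
  obtain ⟨hprob, hmarg, hind⟩ := h.indep_refVisible hp hr h.one_le_T le_rfl
  have hL : Measurable fun ω => ENNReal.ofReal (M.pathRatio D M.T ω) :=
    ((h.measurable_pathRatio hp hr le_rfl).mono (past_le h hp le_rfl) le_rfl).ennreal_ofReal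
  have hW : Measurable (M.Wvirt M.T) :=
    (h.measurable_Wvirt h.one_le_T le_rfl).mono (past_le h hp le_rfl) le_rfl
  set Q := P.withDensity fun ω => ENNReal.ofReal (M.pathRatio D M.T ω) with hQ
  have hF : Measurable fun p : Param d × (Fin n → 𝒵) =>
      ENNReal.ofReal (Real.exp (l * (M.popRisk D p.1 - M.empRisk p.1 p.2))) :=
    ((((h.measurable_popRisk).comp measurable_fst).sub
      h.measurable_empRisk).const_mul l).exp.ennreal_ofReal
  have hFω : Measurable fun ω => ENNReal.ofReal (Real.exp (l *
      (M.popRisk D (M.Wvirt M.T ω) - M.empRisk (M.Wvirt M.T ω) (M.S ω)))) :=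
    hF.comp (hW.prodMk h.measurable_S)
  have hlawS : Q.map M.S = Measure.pi fun _ => D := by
    rw [← h.law_S]
    ext A hA
    rw [Measure.map_apply h.measurable_S hA, Measure.map_apply h.measurable_S hA]
    exact hmarg _ ⟨A, hA, rfl⟩
  have hindF : IndepFun (M.Wvirt M.T) M.S Q :=
    (indep_of_indep_of_le_left hind.symm
      (measurable_Wvirt_refVisible h.one_le_T).comap_le : Indep _ _ Q)
  have hjoint := (indepFun_iff_map_prod_eq_prod_map_map hW.aemeasurable
    h.measurable_S.aemeasurable).1 hindF
  have : IsProbabilityMeasure (Q.map (M.Wvirt M.T)) := Measure.isProbabilityMeasure_map hW.aemeasurable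
  calc _ = ∫⁻ ω, ENNReal.ofReal (Real.exp (l * (M.popRisk D (M.Wvirt M.T ω) -
        M.empRisk (M.Wvirt M.T ω) (M.S ω)))) ∂Q := by
        rw [hQ, lintegral_withDensity_eq_lintegral_mul _ hL
          hFω]
        refine lintegral_congr fun ω => ?_
        rw [mul_comm, ENNReal.ofReal_mul (pathRatio_nonneg _ _ _)]
        rfl
    _ = ∫⁻ p, ENNReal.ofReal (Real.exp (l * (M.popRisk D p.1 - M.empRisk p.1 p.2)))
        ∂(Q.map fun ω => (M.Wvirt M.T ω, M.S ω)) :=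
        (lintegral_map hF (hW.prodMk h.measurable_S)).symm
    _ = ∫⁻ w, ∫⁻ s, ENNReal.ofReal (Real.exp (l * (M.popRisk D w - M.empRisk w s)))
        ∂(Measure.pi fun _ => D) ∂(Q.map (M.Wvirt M.T)) := by
        rw [hjoint, hlawS, lintegral_prod _ hF.aemeasurable]
    _ ≤ ∫⁻ _, ENNReal.ofReal (Real.exp (l ^ 2 * ((R : ℝ) ^ 2 / n) / 2))
          ∂(Q.map (M.Wvirt M.T)) :=
        lintegral_mono fun w => lintegral_exp_popRisk_sub_empRisk_le hn (hsubG w) l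
    _ = _ := by simp

end VirtualSGD

/-! ### Relative entropy of the path -/

theorem integrable_and_integral_eq_of_lintegral_eq {Ω : Type*} [MeasurableSpace Ω]
    {P : Measure Ω} {f g : Ω → ℝ} (hf : AEStronglyMeasurable f P) (hf0 : 0 ≤ᵐ[P] f)
    (hg : Integrable g P) (hg0 : 0 ≤ᵐ[P] g)
    (h : ∫⁻ ω, ENNReal.ofReal (f ω) ∂P = ∫⁻ ω, ENNReal.ofReal (g ω) ∂P) :
    Integrable f P ∧ ∫ ω, f ω ∂P = ∫ ω, g ω ∂P := by
  constructor
  · refine ⟨hf, ?_⟩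
    rw [hasFiniteIntegral_iff_ofReal hf0, h]
    exact (hasFiniteIntegral_iff_ofReal hg0).1 hg.2
  · rw [integral_eq_lintegral_of_nonneg_ae hf0 hf, h,
      integral_eq_lintegral_of_nonneg_ae hg0 hg.1]

theorem Measurable.quadNorm {α : Type*} {m : MeasurableSpace α} {d : ℕ}
    {C : α → Matrix (Fin d) (Fin d) ℝ} {v : α → Param d} (hC : Measurable C) (hv : Measurable v) :
    Measurable fun a => quadNorm (C a) (v a) :=
  measurable_quadNorm.comp (hC.prodMk hv)

theorem Measurable.trace_mul {α : Type*} {m : MeasurableSpace α} {d : ℕ}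
    {A C : α → Matrix (Fin d) (Fin d) ℝ} (hA : Measurable A) (hC : Measurable C) :
    Measurable fun a => (A a * C a).trace :=
  ((continuous_fst.matrix_mul continuous_snd).matrix_trace.measurable (α :=
    Matrix (Fin d) (Fin d) ℝ × Matrix (Fin d) (Fin d) ℝ)).comp (hA.prodMk hC)

/-- The trace is the mean of ‖v‖²_A for v ∼ N(0, C). -/
theorem Matrix.PosSemidef.trace_mul_nonneg {d : ℕ} {A C : Matrix (Fin d) (Fin d) ℝ}
    (hA : A.PosSemidef) (hC : C.PosSemidef) : 0 ≤ (A * C).trace := by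
  have h1 := integral_quadNorm_add A hC 0
  have h2 : quadNorm A (0 : Param d) = 0 := by simp [_root_.quadNorm]
  rw [h2, add_zero] at h1
  rw [← h1]
  exact integral_nonneg fun v => quadNorm_nonneg hA _

theorem log_gaussDens {d : ℕ} {C : Matrix (Fin d) (Fin d) ℝ} (hC : C.PosDef) (v : Param d) :
    Real.log (gaussDens C v) =
      -(1 / 2) * (Real.log ((2 * Real.pi) ^ d) + Real.log C.det + quadNorm C⁻¹ v) := by
  have h1 := hC.det_pos
  unfold gaussDens
  rw [Real.log_mul (by positivity) (Real.exp_pos _).ne', Real.log_exp, Real.log_inv,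
    Real.log_sqrt (by positivity), Real.log_mul (by positivity) h1.ne']
  ring

namespace VirtualSGD

open scoped ENNReal

variable {d n : ℕ} {Ω 𝒵 : Type*} {M : VirtualSGD d n Ω 𝒵}

/-- Only the combined mismatch is assumed integrable; this bound makes the trace, and hence the
log-determinant, integrable separately. -/
theorem trace_le_covMismatch {t : ℕ} {ω : Ω} (hc : (M.cov t ω).PosDef)
    (hr : (M.covRef t ω).PosDef) :
    (M.precRef t ω * M.cov t ω).trace ≤ 2 * M.covMismatch t ω + 2 * (d * Real.log 2) := by
  have h := trace_mul_le_mismatch hr.inv hc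
  rw [Matrix.det_nonsing_inv, Ring.inverse_eq_inv', inv_mul_eq_div, ← inv_div,
    Real.log_inv] at h
  unfold covMismatch precRef
  linarith

variable [MeasurableSpace 𝒵]

/-- The difference ḡ(W_t + ξ_t) - G_t is split at ḡ(W_t). -/
theorem quadNorm_meanShift_le {D : Measure 𝒵} {t : ℕ} (h1 : 1 ≤ t) {ω : Ω}
    (hω : (M.covRef t ω).PosDef) :
    quadNorm (M.precRef t ω) (M.meanShift D t ω) ≤
      2 * M.η t ^ 2 * (M.sensitivity D t ω + M.deviation D t ω) := by
  have h := quadNorm_sub_le hω.inv.posSemidef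
    (M.popGrad D (M.W t ω + M.ξ t ω) - M.popGrad D (M.W t ω)) (M.G t ω - M.popGrad D (M.W t ω))
  rw [sub_sub_sub_cancel_right] at h
  rw [meanShift, quadNorm_smul, M.Wvirt_eq_W_add_ξ' h1]
  calc _ ≤ M.η t ^ 2 * _ := mul_le_mul_of_nonneg_left h (sq_nonneg _)
    _ = _ := by simp only [sensitivity, deviation, precRef]; ring

/-- The powers of 2π cancel. The `+ 0` gives the second quadratic form the shape of
`lintegral_quadNorm_perturbation` with zero shift. -/
theorem log_stepRatio {D : Measure 𝒵} {t : ℕ} {ω : Ω} (hc : (M.cov t ω).PosDef)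
    (hr : (M.covRef t ω).PosDef) :
    -Real.log (M.stepRatio D t ω) = 1 / 2 * (Real.log ((M.covRef t ω).det / (M.cov t ω).det) +
      (quadNorm (M.precRef t ω) (M.ε t ω + M.meanShift D t ω) -
        quadNorm (M.cov t ω)⁻¹ (M.ε t ω + 0))) := by
  rw [stepRatio, Real.log_div (gaussDens_pos hr _).ne' (gaussDens_pos hc _).ne', log_gaussDens hr,
    log_gaussDens hc, Real.log_div hr.det_pos.ne' hc.det_pos.ne', add_zero, precRef]
  ring

theorem stepRatio_pos {D : Measure 𝒵} {t : ℕ} {ω : Ω} (hc : (M.cov t ω).PosDef) (hr : (M.covRef t ω).PosDef) :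
    0 < M.stepRatio D t ω :=
  div_pos (gaussDens_pos hr _) (gaussDens_pos hc _)

variable [m0 : MeasurableSpace Ω] {P : Measure Ω} {D : Measure 𝒵}

/-- `A` and `a` are settled before ε_t, so the Gaussian second-moment formula applies conditionally.
Working in [0, ∞] avoids any prior integrability. -/
theorem IsSGD.lintegral_quadNorm_perturbation [IsProbabilityMeasure P] (h : M.IsSGD P D)
    (hp : M.IsPredictablePerturbation P) {t : ℕ} (h1 : 1 ≤ t) (ht : t < M.T)
    {A : Ω → Matrix (Fin d) (Fin d) ℝ} (hA : Measurable[M.past t] A)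
    (hpsd : ∀ᵐ ω ∂P, (A ω).PosSemidef) {a : Ω → Param d} (ha : Measurable[M.past t] a) :
    ∫⁻ ω, ENNReal.ofReal (quadNorm (A ω) (M.ε t ω + a ω)) ∂P =
      ∫⁻ ω, ENNReal.ofReal ((A ω * M.cov t ω).trace + quadNorm (A ω) (a ω)) ∂P := by
  have hf : Measurable fun p : (Matrix (Fin d) (Fin d) ℝ × Param d) × Param d =>
      ENNReal.ofReal (quadNorm p.1.1 (p.2 + p.1.2)) :=
    (Measurable.quadNorm (by fun_prop) (by fun_prop)).ennreal_ofReal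
  rw [lintegral_of_hasCondGaussianLaw (past_le h hp ht.le) (hp.measurable_ε t h1 ht)
    ((measurable_cov h hp h1 ht).mono le_sup_left le_rfl) (hp.posDef t h1 ht)
    (hp.condLaw t h1 ht) (hA.prodMk ha) hf]
  refine lintegral_congr_ae ?_
  filter_upwards [hpsd, hp.posDef t h1 ht] with ω hω hc
  rw [← ofReal_integral_eq_lintegral_ofReal (integrable_quadNorm_add _ hc.posSemidef _)
    (ae_of_all _ fun v => quadNorm_nonneg hω _), integral_quadNorm_add _ hc.posSemidef]

/-- The expected relative entropy of two conditional Gaussians: the reference quadratic form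
averages to the trace plus the squared mean shift, the true one to d. -/
theorem IsSGD.integrable_log_stepRatio [IsProbabilityMeasure P] [SFinite D] (h : M.IsSGD P D)
    (hp : M.IsPredictablePerturbation P) (hr : M.IsAdmissibleReference P)
    (hfin : M.HasFiniteQuantities P D) {t : ℕ} (h1 : 1 ≤ t) (ht : t < M.T) :
    Integrable (fun ω => Real.log (M.stepRatio D t ω)) P ∧
      -∫ ω, Real.log (M.stepRatio D t ω) ∂P ≤
        M.covCost P t + M.η t ^ 2 * ∫ ω, (M.sensitivity D t ω + M.deviation D t ω) ∂P := by
  have hpast := past_le h hp ht.le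
  have hcov : Measurable[M.past t] (M.cov t) :=
    (measurable_cov h hp h1 ht).mono le_sup_left le_rfl
  have hcr : Measurable[M.past t] (M.covRef t) :=
    (measurable_covRef hr h1 ht).mono (h.refVisible_le_past ht.le) le_rfl
  have hprec : Measurable[M.past t] (M.precRef t) := fun s hs => hcr (measurable_matrix_inv hs)
  have hcinv : Measurable[M.past t] fun ω => (M.cov t ω)⁻¹ :=
    fun s hs => hcov (measurable_matrix_inv hs)
  have hshift := h.measurable_meanShift h1 ht
  have hε := hp.measurable_ε t h1 ht
  have hcov0 : Measurable (M.cov t) := hcov.mono hpast le_rfl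
  have hprec0 : Measurable (M.precRef t) := hprec.mono hpast le_rfl
  have hcinv0 : Measurable fun ω => (M.cov t ω)⁻¹ := hcinv.mono hpast le_rfl
  have hshift0 : Measurable (M.meanShift D t) := hshift.mono hpast le_rfl
  have hpd := hp.posDef t h1 ht
  have hpdr := hr.posDef t h1 ht
  have hsd : Integrable (fun ω => M.sensitivity D t ω + M.deviation D t ω) P :=
    (hfin.sensitivity t h1 ht).add (hfin.deviation t h1 ht)
  have hmis := hfin.covMismatch t h1 ht
  have htr0 : 0 ≤ᵐ[P] fun ω => (M.precRef t ω * M.cov t ω).trace := by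
    filter_upwards [hpd, hpdr] with ω hc hr
    exact Matrix.PosSemidef.trace_mul_nonneg hr.inv.posSemidef hc.posSemidef
  have htr : Integrable (fun ω => (M.precRef t ω * M.cov t ω).trace) P := by
    refine ((hmis.const_mul 2).add (integrable_const (2 * (d * Real.log 2)))).mono'
      (hprec0.trace_mul hcov0).aestronglyMeasurable ?_
    filter_upwards [hpd, hpdr, htr0] with ω hc hr h0
    rw [Real.norm_eq_abs, abs_of_nonneg h0]
    exact trace_le_covMismatch hc hr
  have hqs0 : 0 ≤ᵐ[P] fun ω => quadNorm (M.precRef t ω) (M.meanShift D t ω) :=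
    hpdr.mono fun ω hr => quadNorm_nonneg hr.inv.posSemidef _
  have hqs : Integrable (fun ω => quadNorm (M.precRef t ω) (M.meanShift D t ω)) P := by
    refine (hsd.const_mul (2 * M.η t ^ 2)).mono'
      (hprec0.quadNorm hshift0).aestronglyMeasurable ?_
    filter_upwards [hpdr, hqs0] with ω hr h0
    rw [Real.norm_eq_abs, abs_of_nonneg h0]
    exact quadNorm_meanShift_le h1 hr
  have hlogdet : Integrable (fun ω => Real.log ((M.covRef t ω).det / (M.cov t ω).det)) P := by
    refine ((hmis.sub htr).add (integrable_const (d : ℝ))).congr (ae_of_all _ fun ω => ?_)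
    simp only [Pi.add_apply, Pi.sub_apply, covMismatch]
    ring
  obtain ⟨hq1, hq1'⟩ := integrable_and_integral_eq_of_lintegral_eq
    (f := fun ω => quadNorm (M.precRef t ω) (M.ε t ω + M.meanShift D t ω))
    (hprec0.quadNorm (hε.add hshift0)).aestronglyMeasurable
    (hpdr.mono fun ω hr => quadNorm_nonneg hr.inv.posSemidef _) (htr.add hqs)
    (by filter_upwards [htr0, hqs0] with ω h2 h3 using add_nonneg h2 h3)
    (h.lintegral_quadNorm_perturbation hp h1 ht hprec
      (hpdr.mono fun ω hr => hr.inv.posSemidef) hshift)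
  -- In its own precision the perturbation has mean square tr(Σ_t⁻¹ Σ_t) = d.
  obtain ⟨hq2, hq2'⟩ := integrable_and_integral_eq_of_lintegral_eq (g := fun _ : Ω => (d : ℝ))
    (hcinv0.quadNorm (hε.add_const 0)).aestronglyMeasurable
    (hpd.mono fun ω hc => quadNorm_nonneg hc.inv.posSemidef _) (integrable_const _)
    (ae_of_all _ fun _ => Nat.cast_nonneg d)
    ((h.lintegral_quadNorm_perturbation hp h1 ht hcinv
      (hpd.mono fun ω hc => hc.inv.posSemidef) (a := fun _ => 0)
      (@measurable_const _ _ _ (M.past t) _)).trans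
      (lintegral_congr_ae (hpd.mono fun ω hc => by
        simp only []
        rw [Matrix.nonsing_inv_mul _ hc.det_pos.ne'.isUnit, Matrix.trace_one, Fintype.card_fin]
        simp [quadNorm])))
  have hlog : (fun ω => -Real.log (M.stepRatio D t ω)) =ᵐ[P] fun ω =>
      1 / 2 * (Real.log ((M.covRef t ω).det / (M.cov t ω).det) +
      (quadNorm (M.precRef t ω) (M.ε t ω + M.meanShift D t ω) -
        quadNorm (M.cov t ω)⁻¹ (M.ε t ω + 0))) := by
    filter_upwards [hpd, hpdr] with ω hc hr using log_stepRatio hc hr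
  have hsum := (hlogdet.add (hq1.sub hq2)).const_mul (1 / 2)
  have hneg : Integrable (fun ω => -Real.log (M.stepRatio D t ω)) P := hsum.congr hlog.symm
  refine ⟨by simpa using hneg.neg, ?_⟩
  have hqs_le : ∫ ω, quadNorm (M.precRef t ω) (M.meanShift D t ω) ∂P ≤
      2 * M.η t ^ 2 * ∫ ω, (M.sensitivity D t ω + M.deviation D t ω) ∂P := by
    rw [← integral_const_mul]
    exact integral_mono_ae hqs (hsd.const_mul _)
      (hpdr.mono fun ω hr => quadNorm_meanShift_le h1 hr)
  have hmis' : ∫ ω, M.covMismatch t ω ∂P = ∫ ω, (M.precRef t ω * M.cov t ω).trace ∂P - d +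
      ∫ ω, Real.log ((M.covRef t ω).det / (M.cov t ω).det) ∂P := by
    unfold covMismatch
    have h2 : Integrable (fun ω => (M.precRef t ω * M.cov t ω).trace - (d : ℝ)) P :=
      htr.sub (integrable_const _)
    rw [integral_add h2 hlogdet, integral_sub htr (integrable_const _)]
    simp
  have hsum' : ∫ ω, 1 / 2 * (Real.log ((M.covRef t ω).det / (M.cov t ω).det) +
      (quadNorm (M.precRef t ω) (M.ε t ω + M.meanShift D t ω) -
        quadNorm (M.cov t ω)⁻¹ (M.ε t ω + 0))) ∂P =
      1 / 2 * (∫ ω, Real.log ((M.covRef t ω).det / (M.cov t ω).det) ∂P +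
        (∫ ω, (M.precRef t ω * M.cov t ω).trace ∂P +
          ∫ ω, quadNorm (M.precRef t ω) (M.meanShift D t ω) ∂P - d)) := by
    have hq12 : Integrable (fun ω => quadNorm (M.precRef t ω) (M.ε t ω + M.meanShift D t ω) -
        quadNorm (M.cov t ω)⁻¹ (M.ε t ω + 0)) P := hq1.sub hq2
    rw [integral_const_mul, integral_add hlogdet hq12, integral_sub hq1 hq2, hq2']
    have h3 : ∫ ω, quadNorm (M.precRef t ω) (M.ε t ω + M.meanShift D t ω) ∂P =
        ∫ ω, (M.precRef t ω * M.cov t ω).trace ∂P +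
          ∫ ω, quadNorm (M.precRef t ω) (M.meanShift D t ω) ∂P := by
      rw [← integral_add htr hqs]
      exact hq1'
    rw [h3]
    simp
  rw [← integral_neg, integral_congr_ae hlog, hsum', covCost, hmis']
  linarith

theorem ae_forall_stepRatio_pos (hp : M.IsPredictablePerturbation P)
    (hr : M.IsAdmissibleReference P) :
    ∀ᵐ ω ∂P, ∀ t ∈ Finset.Ico 1 M.T, 0 < M.stepRatio D t ω := by
  rw [Finset.eventually_all]
  intro t ht
  rw [Finset.mem_Ico] at ht
  filter_upwards [hp.posDef t ht.1 ht.2, hr.posDef t ht.1 ht.2] with ω hc hr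
  exact stepRatio_pos hc hr

theorem IsSGD.integrable_log_pathRatio [IsProbabilityMeasure P] [SFinite D] (h : M.IsSGD P D)
    (hp : M.IsPredictablePerturbation P) (hr : M.IsAdmissibleReference P)
    (hfin : M.HasFiniteQuantities P D) :
    Integrable (fun ω => Real.log (M.pathRatio D M.T ω)) P ∧
      -∫ ω, Real.log (M.pathRatio D M.T ω) ∂P ≤ ∑ t ∈ Finset.Ico 1 M.T,
        (2 * M.η t ^ 2 * (∫ ω, (M.Vad P D t ω + M.Γad P D t ω) ∂P) + M.covCost P t) := by
  have hlog : (fun ω => Real.log (M.pathRatio D M.T ω)) =ᵐ[P]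
      fun ω => ∑ t ∈ Finset.Ico 1 M.T, Real.log (M.stepRatio D t ω) := by
    filter_upwards [ae_forall_stepRatio_pos (D := D) hp hr] with ω hω
    exact Real.log_prod fun t ht => (hω t ht).ne'
  have hstep : ∀ t ∈ Finset.Ico 1 M.T, _ := fun t ht =>
    h.integrable_log_stepRatio hp hr hfin (Finset.mem_Ico.1 ht).1 (Finset.mem_Ico.1 ht).2
  refine ⟨(integrable_finsetSum _ fun t ht => (hstep t ht).1).congr hlog.symm, ?_⟩
  rw [integral_congr_ae hlog, integral_finsetSum _ fun t ht => (hstep t ht).1,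
    ← Finset.sum_neg_distrib]
  refine Finset.sum_le_sum fun t ht => ?_
  refine (hstep t ht).2.trans ?_
  rw [Finset.mem_Ico] at ht
  have haux : M.histAux t ≤ m0 :=
    (sup_le (h.hist_le_exogenous (by omega)) U_le_exogenous).trans h.exogenous_le
  have hV : ∫ ω, (M.Vad P D t ω + M.Γad P D t ω) ∂P =
      ∫ ω, (M.sensitivity D t ω + M.deviation D t ω) ∂P := by
    unfold Vad Γad
    rw [integral_add integrable_condExp integrable_condExp,
      integral_add (hfin.sensitivity t ht.1 ht.2) (hfin.deviation t ht.1 ht.2),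
      integral_condExp haux, integral_condExp haux, add_comm]
  have hnn : 0 ≤ ∫ ω, (M.sensitivity D t ω + M.deviation D t ω) ∂P :=
    integral_nonneg_of_ae ((hr.posDef t ht.1 ht.2).mono fun ω hω =>
      add_nonneg (quadNorm_nonneg hω.inv.posSemidef _) (quadNorm_nonneg hω.inv.posSemidef _))
  rw [hV]
  -- The one-step estimate has coefficient η_t², the claimed bound 2η_t²; nonnegativity of the
  -- expectation absorbs the difference.
  nlinarith [mul_nonneg (sq_nonneg (M.η t)) hnn]

theorem IsSGD.integrable_and_abs_integral_popRisk_sub_empRisk_le [IsProbabilityMeasure P]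
    [IsProbabilityMeasure D] (hn : 0 < n) {R : ℝ≥0} (h : M.IsSGD P D)
    (hp : M.IsPredictablePerturbation P) (hr : M.IsAdmissibleReference P)
    (hfin : M.HasFiniteQuantities P D)
    (hsubG : ∀ w, HasSubgaussianMGF (fun z => M.loss w z - ∫ z', M.loss w z' ∂D) (R ^ 2) D) :
    Integrable (fun ω => M.popRisk D (M.Wvirt M.T ω) - M.empRisk (M.Wvirt M.T ω) (M.S ω)) P ∧
      |∫ ω, (M.popRisk D (M.Wvirt M.T ω) - M.empRisk (M.Wvirt M.T ω) (M.S ω)) ∂P| ≤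
        √(2 * (R : ℝ) ^ 2 / n * ∑ t ∈ Finset.Ico 1 M.T,
          (2 * M.η t ^ 2 * (∫ ω, (M.Vad P D t ω + M.Γad P D t ω) ∂P) + M.covCost P t)) := by
  have hW : Measurable (M.Wvirt M.T) :=
    (h.measurable_Wvirt h.one_le_T le_rfl).mono (past_le h hp le_rfl) le_rfl
  obtain ⟨hlog, hle⟩ := h.integrable_log_pathRatio hp hr hfin
  obtain ⟨hint, hbd⟩ := integrable_and_abs_integral_le_of_change_of_measure
    ((h.measurable_popRisk.comp hW).sub (h.measurable_empRisk.comp (hW.prodMk h.measurable_S)))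
    ((h.measurable_pathRatio (D := D) hp hr le_rfl).mono (past_le h hp le_rfl) le_rfl)
    ((ae_forall_stepRatio_pos hp hr).mono fun ω hω => Finset.prod_pos hω) hlog
    (h.lintegral_exp_mul_pathRatio_le hn hp hr hsubG)
  refine ⟨hint, hbd.trans (Real.sqrt_le_sqrt ?_)⟩
  rw [← mul_div_assoc]
  exact mul_le_mul_of_nonneg_left hle (by positivity)

end VirtualSGD

/-! ### The accumulated perturbation and the ghost sample -/

open scoped ENNReal in
-- The identity for nonnegative functions determines the joint law as a measure with Gaussian
-- density; Fubini then covers signed integrable functions.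
theorem integrable_and_integral_integral_multivariateGaussian {d : ℕ} {Ω 𝒴 : Type*}
    [MeasurableSpace Ω] [MeasurableSpace 𝒴] {P : Measure Ω} [IsProbabilityMeasure P]
    {Y : Ω → 𝒴} (hY : Measurable Y) {X : Ω → Param d} (hX : Measurable X)
    {C : Ω → Matrix (Fin d) (Fin d) ℝ} (hC : Measurable C) (hpd : ∀ᵐ ω ∂P, (C ω).PosDef)
    (hlaw : ∀ f : (𝒴 × Matrix (Fin d) (Fin d) ℝ) × Param d → ℝ≥0∞, Measurable f →
      ∫⁻ ω, f ((Y ω, C ω), X ω) ∂P =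
        ∫⁻ ω, ∫⁻ v, f ((Y ω, C ω), v) ∂(multivariateGaussian (0 : Param d) (C ω)) ∂P)
    {F : 𝒴 × Param d → ℝ} (hF : Measurable F) (hint : Integrable (fun ω => F (Y ω, X ω)) P) :
    Integrable (fun ω => ∫ v, F (Y ω, v) ∂(multivariateGaussian (0 : Param d) (C ω))) P ∧
      ∫ ω, ∫ v, F (Y ω, v) ∂(multivariateGaussian (0 : Param d) (C ω)) ∂P =
        ∫ ω, F (Y ω, X ω) ∂P := by
  have hYC : Measurable fun ω => (Y ω, C ω) := hY.prodMk hC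
  have hdm : Measurable fun p : (𝒴 × Matrix (Fin d) (Fin d) ℝ) × Param d =>
      ENNReal.ofReal (gaussDens p.1.2 p.2) :=
    (Measurable.gaussDens (by fun_prop) (by fun_prop)).ennreal_ofReal
  have : IsProbabilityMeasure (P.map fun ω => (Y ω, C ω)) :=
    Measure.isProbabilityMeasure_map hYC.aemeasurable
  have hmap : P.map (fun ω => ((Y ω, C ω), X ω)) =
      ((P.map fun ω => (Y ω, C ω)).prod volume).withDensity
        fun p => ENNReal.ofReal (gaussDens p.1.2 p.2) := by
    ext A hA
    have hAm := measurable_indicator_one hA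
    rw [← lintegral_indicator_one hA, ← lintegral_indicator_one hA,
      lintegral_map hAm (hYC.prodMk hX), hlaw _ hAm,
      lintegral_withDensity_eq_lintegral_mul _ hdm hAm,
      lintegral_prod _ (hdm.mul hAm).aemeasurable,
      lintegral_map (hdm.mul hAm).lintegral_prod_right' hYC]
    refine lintegral_congr_ae (hpd.mono fun ω hω => ?_)
    exact lintegral_multivariateGaussian hω (f := fun v => A.indicator 1 ((Y ω, C ω), v))
      (hAm.comp measurable_prodMk_left)
  have hF' : Measurable fun p : (𝒴 × Matrix (Fin d) (Fin d) ℝ) × Param d => F (p.1.1, p.2) := by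
    fun_prop
  have h1 : Integrable (fun p : (𝒴 × Matrix (Fin d) (Fin d) ℝ) × Param d => F (p.1.1, p.2))
      (P.map fun ω => ((Y ω, C ω), X ω)) :=
    (integrable_map_measure hF'.aestronglyMeasurable (hYC.prodMk hX).aemeasurable).2 hint
  rw [hmap, integrable_withDensity_iff_integrable_smul' hdm (by simp)] at h1
  have hinner : ∀ᵐ ω ∂P, ∫ v, F (Y ω, v) ∂(multivariateGaussian (0 : Param d) (C ω)) =
      ∫ v, (ENNReal.ofReal (gaussDens (C ω) v)).toReal • F (Y ω, v) := hpd.mono fun ω hω => by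
    have hm : Measurable fun v : Param d => ENNReal.ofReal (gaussDens (C ω) v) :=
      (measurable_const.gaussDens measurable_id).ennreal_ofReal
    rw [multivariateGaussian_eq_withDensity hω,
      integral_withDensity_eq_integral_toReal_smul hm (by simp)]
  have h2 := h1.integral_prod_left
  have h3 := (integrable_map_measure h2.aestronglyMeasurable hYC.aemeasurable).1 h2
  refine ⟨h3.congr (hinner.mono fun ω hω => hω.symm), ?_⟩
  rw [integral_congr_ae hinner]
  calc _ = ∫ q, (∫ v, (ENNReal.ofReal (gaussDens q.2 v)).toReal • F (q.1, v))
        ∂(P.map fun ω => (Y ω, C ω)) :=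
        (integral_map hYC.aemeasurable h2.aestronglyMeasurable).symm
    _ = ∫ p, F (p.1.1, p.2) ∂(P.map fun ω => ((Y ω, C ω), X ω)) := by
        rw [hmap, integral_withDensity_eq_integral_toReal_smul hdm (by simp), integral_prod _ h1]
    _ = _ := integral_map (hYC.prodMk hX).aemeasurable hF'.aestronglyMeasurable

theorem multivariateGaussian_zero_zero {d : ℕ} :
    multivariateGaussian (0 : Param d) (0 : Matrix (Fin d) (Fin d) ℝ) = Measure.dirac 0 := by
  simp [multivariateGaussian]

namespace VirtualSGD

open scoped ENNReal

variable {d n : ℕ} {Ω 𝒵 : Type*} {M : VirtualSGD d n Ω 𝒵}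

theorem accCov_succ (M : VirtualSGD d n Ω 𝒵) {t : ℕ} (h1 : 1 ≤ t) (ω : Ω) :
    M.accCov (t + 1) ω = M.accCov t ω + M.cov t ω :=
  Finset.sum_Ico_succ_top h1 _

theorem accCov_one (M : VirtualSGD d n Ω 𝒵) (ω : Ω) : M.accCov 1 ω = 0 := by simp [accCov]

theorem ξ_one (M : VirtualSGD d n Ω 𝒵) (ω : Ω) : M.ξ 1 ω = 0 := by simp [ξ]

variable [MeasurableSpace 𝒵]

theorem integral_popRisk_sub_empRisk {D : Measure 𝒵} [IsProbabilityMeasure D] (hn : 0 < n) {w : Param d}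
    (hint : Integrable (M.loss w) D) :
    ∫ s : Fin n → 𝒵, (M.popRisk D w - M.empRisk w s) ∂(Measure.pi fun _ => D) = 0 := by
  have hi : ∀ i, Integrable (fun s : Fin n → 𝒵 => M.loss w (s i)) (Measure.pi fun _ => D) :=
    fun i => (measurePreserving_eval (fun _ : Fin n => D) i).integrable_comp_of_integrable hint
  have hi' : ∀ i, ∫ s : Fin n → 𝒵, M.loss w (s i) ∂(Measure.pi fun _ => D) = M.popRisk D w := by
    intro i
    have hmp := measurePreserving_eval (fun _ : Fin n => D) i
    have h2 := integral_map (f := M.loss w) hmp.measurable.aemeasurable (by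
      rw [hmp.map_eq]; exact hint.1)
    rw [hmp.map_eq] at h2
    exact h2.symm
  have hn' : (n : ℝ) ≠ 0 := by positivity
  unfold empRisk
  rw [integral_sub (integrable_const _) ((integrable_finsetSum _ fun i _ => hi i).const_mul _),
    integral_const_mul, integral_finsetSum _ fun i _ => hi i]
  simp [hi', hn']

variable [m0 : MeasurableSpace Ω] {P : Measure Ω} {D : Measure 𝒵}

theorem ae_posSemidef_accCov (hp : M.IsPredictablePerturbation P) {t : ℕ} (ht : t ≤ M.T) :
    ∀ᵐ ω ∂P, (M.accCov t ω).PosSemidef := by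
  have : ∀ᵐ ω ∂P, ∀ s ∈ Finset.Ico 1 t, (M.cov s ω).PosDef := by
    rw [Finset.eventually_all]
    intro s hs
    rw [Finset.mem_Ico] at hs
    exact hp.posDef s hs.1 (hs.2.trans_le ht)
  exact this.mono fun ω hω => Matrix.posSemidef_sum _ fun s hs => (hω s hs).posSemidef

/-- The last summand is definite and the others are semidefinite. The sum is empty at t = 1, hence
the strict inequality. -/
theorem ae_posDef_accCov (hp : M.IsPredictablePerturbation P) {t : ℕ} (h1 : 1 < t)
    (ht : t ≤ M.T) : ∀ᵐ ω ∂P, (M.accCov t ω).PosDef := by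
  obtain ⟨s, rfl⟩ := Nat.exists_eq_add_of_le' h1.le
  filter_upwards [ae_posSemidef_accCov hp (t := s) (by omega), hp.posDef s (by omega) (by omega)]
    with ω h2 h3
  rw [accCov_succ _ (by omega)]
  exact h3.posSemidef_add h2

/-- Given all randomness except the virtual perturbations, the accumulated perturbation is
centred Gaussian with the accumulated covariance. -/
theorem IsSGD.lintegral_comp_ξ [IsProbabilityMeasure P] (h : M.IsSGD P D)
    (hp : M.IsPredictablePerturbation P) {t : ℕ} (h1 : 1 ≤ t) (ht : t ≤ M.T) {𝒴 : Type*}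
    [MeasurableSpace 𝒴] {Y : Ω → 𝒴} (hY : Measurable[M.exogenous] Y) {f : 𝒴 × Param d → ℝ≥0∞}
    (hf : Measurable f) :
    ∫⁻ ω, f (Y ω, M.ξ t ω) ∂P =
      ∫⁻ ω, ∫⁻ v, f (Y ω, v) ∂(multivariateGaussian (0 : Param d) (M.accCov t ω)) ∂P := by
  -- `Y` must stay arbitrary: the induction hypothesis is applied to the pair of `Y` and Σ_t, after
  -- ε_t has been integrated out.
  induction t, h1 using Nat.le_induction generalizing 𝒴 with
  | base =>
    refine lintegral_congr fun ω => ?_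
    rw [accCov_one, multivariateGaussian_zero_zero, ξ_one, lintegral_dirac]
  | succ t h1 ih =>
    have ht' : t < M.T := ht
    have hcov := measurable_cov h hp h1 ht'
    have hYξ : Measurable[M.past t] fun ω => (Y ω, M.ξ t ω) :=
      (hY.mono le_sup_left le_rfl).prodMk ((M.measurable_ξ t).mono le_sup_right le_rfl)
    have hf1 : Measurable fun p : (𝒴 × Param d) × Param d => f (p.1.1, p.1.2 + p.2) := by fun_prop
    have hg : Measurable fun p : (𝒴 × Matrix (Fin d) (Fin d) ℝ) × Param d =>
        ∫⁻ v, ENNReal.ofReal (gaussDens p.1.2 v) * f (p.1.1, p.2 + v) := by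
      refine Measurable.lintegral_prod_right' (f := fun q : ((𝒴 × Matrix (Fin d) (Fin d) ℝ) ×
        Param d) × Param d => ENNReal.ofReal (gaussDens q.1.1.2 q.2) * f (q.1.1.1, q.1.2 + q.2)) ?_
      exact (Measurable.gaussDens (by fun_prop) (by fun_prop)).ennreal_ofReal.mul (by fun_prop)
    have hdens : ∀ᵐ ω ∂P, ∀ x,
        ∫⁻ v, f (Y ω, x + v) ∂(multivariateGaussian (0 : Param d) (M.cov t ω)) =
        ∫⁻ v, ENNReal.ofReal (gaussDens (M.cov t ω) v) * f (Y ω, x + v) :=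
      (hp.posDef t h1 ht').mono fun ω hω x =>
        lintegral_multivariateGaussian hω (f := fun v => f (Y ω, x + v)) (by fun_prop)
    have hξ : ∀ ω, M.ξ (t + 1) ω = M.ξ t ω + M.ε t ω := fun ω => Finset.sum_Ico_succ_top h1 _
    calc ∫⁻ ω, f (Y ω, M.ξ (t + 1) ω) ∂P
        = ∫⁻ ω, ∫⁻ v, f (Y ω, M.ξ t ω + v)
            ∂(multivariateGaussian (0 : Param d) (M.cov t ω)) ∂P := by
          simp_rw [hξ]
          exact lintegral_of_hasCondGaussianLaw (past_le h hp ht'.le) (hp.measurable_ε t h1 ht')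
            (hcov.mono le_sup_left le_rfl) (hp.posDef t h1 ht') (hp.condLaw t h1 ht') hYξ hf1
      _ = ∫⁻ ω, (∫⁻ v, ENNReal.ofReal (gaussDens (M.cov t ω) v) * f (Y ω, M.ξ t ω + v)) ∂P :=
          lintegral_congr_ae (hdens.mono fun ω hω => hω _)
      _ = ∫⁻ ω, ∫⁻ x, (∫⁻ v, ENNReal.ofReal (gaussDens (M.cov t ω) v) * f (Y ω, x + v))
            ∂(multivariateGaussian (0 : Param d) (M.accCov t ω)) ∂P :=
          ih ht'.le (hY.prodMk hcov) hg
      _ = _ := by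
          refine lintegral_congr_ae ?_
          filter_upwards [hdens, ae_posSemidef_accCov hp ht'.le, hp.posDef t h1 ht'] with ω h2 h3 h4
          simp_rw [← h2]
          -- With both covariances frozen, successive integration over the two Gaussians is
          -- integration over their convolution.
          rw [accCov_succ _ h1, ← multivariateGaussian_conv h3 h4.posSemidef,
            Measure.lintegral_conv (f := fun v => f (Y ω, v)) (by fun_prop)]

/-- The ghost sample is independent of everything else. -/
theorem IsSGD.map_prodMk_S' [IsProbabilityMeasure P] (h : M.IsSGD P D)
    (hp : M.IsPredictablePerturbation P) {𝒴 : Type*} [MeasurableSpace 𝒴] {Y : Ω → 𝒴}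
    (hY : Measurable[M.past M.T] Y) :
    P.map (fun ω => (Y ω, M.S' ω)) = (P.map Y).prod (Measure.pi fun _ => D) := by
  have hY0 : Measurable Y := hY.mono (past_le h hp le_rfl) le_rfl
  have hind : IndepFun Y M.S' P :=
    (indep_of_indep_of_le_left h.indep_S'.symm hY.comap_le : Indep _ _ P)
  rw [(indepFun_iff_map_prod_eq_prod_map_map hY0.aemeasurable h.measurable_S'.aemeasurable).1 hind,
    h.law_S']

theorem IsSGD.lintegral_comp_S' [IsProbabilityMeasure P] [IsProbabilityMeasure D]
    (h : M.IsSGD P D) (hp : M.IsPredictablePerturbation P) {𝒴 : Type*} [MeasurableSpace 𝒴]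
    {Y : Ω → 𝒴} (hY : Measurable[M.past M.T] Y) {f : 𝒴 × (Fin n → 𝒵) → ℝ≥0∞}
    (hf : Measurable f) :
    ∫⁻ ω, f (Y ω, M.S' ω) ∂P = ∫⁻ s, ∫⁻ ω, f (Y ω, s) ∂P ∂(Measure.pi fun _ => D) := by
  have hY0 : Measurable Y := hY.mono (past_le h hp le_rfl) le_rfl
  have : IsProbabilityMeasure (P.map Y) := Measure.isProbabilityMeasure_map hY0.aemeasurable
  rw [← lintegral_map hf (hY0.prodMk h.measurable_S'), h.map_prodMk_S' hp hY,
    lintegral_prod_symm _ hf.aemeasurable]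
  exact lintegral_congr fun s => lintegral_map (hf.comp measurable_prodMk_right) hY0

/-- The ghost sample is not exogenous, so it is first frozen at s by independence, the Gaussian law
of ξ_T is used for each s, and the randomness of S' is then restored. -/
theorem IsSGD.lintegral_comp_S'_ξ [IsProbabilityMeasure P] [IsProbabilityMeasure D]
    (h : M.IsSGD P D) (hp : M.IsPredictablePerturbation P) (hT : 1 < M.T) {𝒴 : Type*}
    [MeasurableSpace 𝒴] {Y : Ω → 𝒴} (hY : Measurable[M.exogenous] Y)
    {f : ((𝒴 × (Fin n → 𝒵)) × Matrix (Fin d) (Fin d) ℝ) × Param d → ℝ≥0∞} (hf : Measurable f) :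
    ∫⁻ ω, f (((Y ω, M.S' ω), M.accCov M.T ω), M.ξ M.T ω) ∂P =
      ∫⁻ ω, ∫⁻ v, f (((Y ω, M.S' ω), M.accCov M.T ω), v)
        ∂(multivariateGaussian (0 : Param d) (M.accCov M.T ω)) ∂P := by
  have hC := measurable_accCov h hp (le_refl M.T)
  have hYC : Measurable[M.exogenous] fun ω => (Y ω, M.accCov M.T ω) := hY.prodMk hC
  have hYCξ : Measurable[M.past M.T] fun ω => ((Y ω, M.accCov M.T ω), M.ξ M.T ω) :=
    (hYC.mono le_sup_left le_rfl).prodMk ((M.measurable_ξ M.T).mono le_sup_right le_rfl)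
  have hg : Measurable fun p : (𝒴 × Matrix (Fin d) (Fin d) ℝ) × (Fin n → 𝒵) =>
      ∫⁻ v, ENNReal.ofReal (gaussDens p.1.2 v) * f (((p.1.1, p.2), p.1.2), v) := by
    refine Measurable.lintegral_prod_right' (f := fun q : ((𝒴 × Matrix (Fin d) (Fin d) ℝ) ×
      (Fin n → 𝒵)) × Param d => ENNReal.ofReal (gaussDens q.1.1.2 q.2) *
        f (((q.1.1.1, q.1.2), q.1.1.2), q.2)) ?_
    exact (Measurable.gaussDens (by fun_prop) (by fun_prop)).ennreal_ofReal.mul (by fun_prop)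
  have hdens : ∀ᵐ ω ∂P, ∀ s, ∫⁻ v, f (((Y ω, s), M.accCov M.T ω), v)
        ∂(multivariateGaussian (0 : Param d) (M.accCov M.T ω)) =
      ∫⁻ v, ENNReal.ofReal (gaussDens (M.accCov M.T ω) v) *
        f (((Y ω, s), M.accCov M.T ω), v) :=
    (ae_posDef_accCov hp hT le_rfl).mono fun ω hω s =>
      lintegral_multivariateGaussian hω (f := fun v => f (((Y ω, s), M.accCov M.T ω), v))
        (by fun_prop)
  calc _ = ∫⁻ s, ∫⁻ ω, f (((Y ω, s), M.accCov M.T ω), M.ξ M.T ω) ∂P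
        ∂(Measure.pi fun _ => D) :=
        h.lintegral_comp_S' hp hYCξ (f := fun p => f (((p.1.1.1, p.2), p.1.1.2), p.1.2))
          (by fun_prop)
    _ = ∫⁻ s, ∫⁻ ω, (∫⁻ v, ENNReal.ofReal (gaussDens (M.accCov M.T ω) v) *
        f (((Y ω, s), M.accCov M.T ω), v)) ∂P ∂(Measure.pi fun _ => D) := by
        refine lintegral_congr fun s => ?_
        rw [h.lintegral_comp_ξ hp h.one_le_T le_rfl hYC
          (f := fun p => f (((p.1.1, s), p.1.2), p.2)) (by fun_prop)]
        exact lintegral_congr_ae (hdens.mono fun ω hω => hω s)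
    _ = ∫⁻ ω, (∫⁻ v, ENNReal.ofReal (gaussDens (M.accCov M.T ω) v) *
        f (((Y ω, M.S' ω), M.accCov M.T ω), v)) ∂P :=
        (h.lintegral_comp_S' hp (hYC.mono le_sup_left le_rfl) hg).symm
    _ = _ := lintegral_congr_ae (hdens.mono fun ω hω => (hω _).symm)

/-- Averaging over a fresh Gaussian perturbation has the same effect as the accumulated virtual
perturbation. -/
theorem IsSGD.integral_integral_accCov [IsProbabilityMeasure P] [IsProbabilityMeasure D]
    (h : M.IsSGD P D) (hp : M.IsPredictablePerturbation P) {𝒴 : Type*}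
    [MeasurableSpace 𝒴] {Y : Ω → 𝒴} (hY : Measurable[M.exogenous] Y)
    {F : (𝒴 × (Fin n → 𝒵)) × Param d → ℝ} (hF : Measurable F)
    (hint : Integrable (fun ω => F ((Y ω, M.S' ω), M.ξ M.T ω)) P) :
    Integrable (fun ω => ∫ v, F ((Y ω, M.S' ω), v)
        ∂(multivariateGaussian (0 : Param d) (M.accCov M.T ω))) P ∧
      ∫ ω, ∫ v, F ((Y ω, M.S' ω), v)
        ∂(multivariateGaussian (0 : Param d) (M.accCov M.T ω)) ∂P =
        ∫ ω, F ((Y ω, M.S' ω), M.ξ M.T ω) ∂P := by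
  rcases h.one_le_T.eq_or_lt with hT | hT
  -- For T = 1 the accumulated covariance is 0 and the Gaussian is a point mass, so the density
  -- argument is replaced by direct evaluation.
  · have : ∀ ω, ∫ v, F ((Y ω, M.S' ω), v)
        ∂(multivariateGaussian (0 : Param d) (M.accCov M.T ω)) =
        F ((Y ω, M.S' ω), M.ξ M.T ω) := fun ω => by
      rw [← hT, accCov_one, multivariateGaussian_zero_zero, ξ_one, integral_dirac]
    simp_rw [this]
    exact ⟨hint, trivial⟩
  · have hY0 : Measurable Y := hY.mono h.exogenous_le le_rfl
    exact integrable_and_integral_integral_multivariateGaussian (hY0.prodMk h.measurable_S')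
      ((M.measurable_ξ M.T).mono (sigmaPerturb_le hp le_rfl) le_rfl)
      ((measurable_accCov h hp le_rfl).mono h.exogenous_le le_rfl) (ae_posDef_accCov hp hT le_rfl)
      (fun f hf => h.lintegral_comp_S'_ξ hp hT hY hf) hF hint

/-- For a parameter independent of S' the empirical risk is unbiased. Integrability comes from |x| ≤
e^x + e^{-x} and exponential moments bounded uniformly in the parameter. -/
theorem IsSGD.integrable_and_integral_ghost [IsProbabilityMeasure P] [IsProbabilityMeasure D]
    (hn : 0 < n) {R : ℝ≥0} (h : M.IsSGD P D) (hp : M.IsPredictablePerturbation P)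
    (hsubG : ∀ w, HasSubgaussianMGF (fun z => M.loss w z - ∫ z', M.loss w z' ∂D) (R ^ 2) D)
    {w : Ω → Param d} (hw : Measurable[M.past M.T] w) :
    Integrable (fun ω => M.popRisk D (w ω) - M.empRisk (w ω) (M.S' ω)) P ∧
      ∫ ω, (M.popRisk D (w ω) - M.empRisk (w ω) (M.S' ω)) ∂P = 0 := by
  have hw0 : Measurable w := hw.mono (past_le h hp le_rfl) le_rfl
  have hF : Measurable fun p : Param d × (Fin n → 𝒵) => M.popRisk D p.1 - M.empRisk p.1 p.2 :=
    (h.measurable_popRisk.comp measurable_fst).sub h.measurable_empRisk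
  have : IsProbabilityMeasure (P.map w) := Measure.isProbabilityMeasure_map hw0.aemeasurable
  have hpair : Measurable fun ω => (w ω, M.S' ω) := hw0.prodMk h.measurable_S'
  have hprod : Integrable (fun p : Param d × (Fin n → 𝒵) => M.popRisk D p.1 - M.empRisk p.1 p.2)
      ((P.map w).prod (Measure.pi fun _ => D)) := by
    refine ⟨hF.aestronglyMeasurable, ?_⟩
    rw [hasFiniteIntegral_iff_norm]
    have hle : ∀ x : ℝ, ENNReal.ofReal ‖x‖ ≤
        ENNReal.ofReal (Real.exp (1 * x)) + ENNReal.ofReal (Real.exp (-1 * x)) := fun x => by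
      rw [← ENNReal.ofReal_add (Real.exp_pos _).le (Real.exp_pos _).le]
      refine ENNReal.ofReal_le_ofReal (abs_le.2 ⟨?_, ?_⟩)
      · linarith [Real.add_one_le_exp (-1 * x), Real.exp_pos (1 * x)]
      · linarith [Real.add_one_le_exp (1 * x), Real.exp_pos (-1 * x)]
    have hexp : ∀ l : ℝ, Measurable fun p : Param d × (Fin n → 𝒵) =>
        ENNReal.ofReal (Real.exp (l * (M.popRisk D p.1 - M.empRisk p.1 p.2))) :=
      fun l => (hF.const_mul l).exp.ennreal_ofReal
    have hbd : ∀ l : ℝ, ∫⁻ p, ENNReal.ofReal (Real.exp (l * (M.popRisk D p.1 - M.empRisk p.1 p.2)))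
        ∂((P.map w).prod (Measure.pi fun _ => D)) < ∞ := fun l => by
      rw [lintegral_prod _ (hexp l).aemeasurable]
      calc _ ≤ ∫⁻ _, ENNReal.ofReal (Real.exp (l ^ 2 * ((R : ℝ) ^ 2 / n) / 2)) ∂(P.map w) :=
            lintegral_mono fun w => lintegral_exp_popRisk_sub_empRisk_le hn (hsubG w) l
        _ < ∞ := by simp
    refine (lintegral_mono fun p => hle _).trans_lt ?_
    rw [lintegral_add_left (hexp 1)]
    exact ENNReal.add_lt_top.2 ⟨hbd 1, hbd (-1)⟩
  rw [← h.map_prodMk_S' hp hw] at hprod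
  refine ⟨(integrable_map_measure hF.aestronglyMeasurable hpair.aemeasurable).1 hprod, ?_⟩
  have h1 := integral_map hpair.aemeasurable hF.aestronglyMeasurable (μ := P)
  simp only [] at h1
  rw [← h1]
  rw [h.map_prodMk_S' hp hw] at hprod ⊢
  rw [integral_prod _ hprod]
  refine integral_eq_zero_of_ae (ae_of_all _ fun w => ?_)
  refine integral_popRisk_sub_empRisk hn ?_
  exact ((hsubG w).integrable.add (integrable_const (∫ z', M.loss w z' ∂D))).congr
    (ae_of_all _ fun z => by simp)

end VirtualSGD

/-! ### The generalization bound -/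

theorem mainTheorem1 {d n : ℕ} (hn : 0 < n) {Ω 𝒵 : Type*} [MeasurableSpace Ω]
    [MeasurableSpace 𝒵] (P : Measure Ω) [IsProbabilityMeasure P]
    (D : Measure 𝒵) [IsProbabilityMeasure D] (R : ℝ≥0) (M : VirtualSGD d n Ω 𝒵)
    (hsgd : M.IsSGD P D)
    (hsubG : ∀ w, HasSubgaussianMGF (fun z => M.loss w z - ∫ z', M.loss w z' ∂D) (R ^ 2) D)
    (hpert : M.IsPredictablePerturbation P)
    (href : M.IsAdmissibleReference P)
    (hfin : M.HasFiniteQuantities P D) :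
    Integrable
        (fun ω => M.empRisk (M.W M.T ω) (M.S' ω) - M.empRisk (M.W M.T ω) (M.S ω)) P ∧
      |M.gen P| ≤
        Real.sqrt (2 * (R : ℝ) ^ 2 / n *
          ∑ t ∈ Finset.Ico 1 M.T,
            (2 * M.η t ^ 2 * (∫ ω, (M.Vad P D t ω + M.Γad P D t ω) ∂P) + M.covCost P t)) +
        M.outputPenalty P := by
  obtain ⟨hS, hbound⟩ :=
    hsgd.integrable_and_abs_integral_popRisk_sub_empRisk_le hn hpert href hfin hsubG
  obtain ⟨hS', hzero⟩ := hsgd.integrable_and_integral_ghost hn hpert hsubG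
    (hsgd.measurable_Wvirt hsgd.one_le_T le_rfl)
  let F : ((Param d × (Fin n → 𝒵)) × (Fin n → 𝒵)) × Param d → ℝ := fun p =>
    M.empRisk (p.1.1.1 + p.2) p.1.2 - M.empRisk (p.1.1.1 + p.2) p.1.1.2
  have hF : Measurable F := by
    have i1 : Measurable fun p : ((Param d × (Fin n → 𝒵)) × (Fin n → 𝒵)) × Param d =>
      (p.1.1.1 + p.2, p.1.2) := by fun_prop
    have i2 : Measurable fun p : ((Param d × (Fin n → 𝒵)) × (Fin n → 𝒵)) × Param d =>
      (p.1.1.1 + p.2, p.1.1.2) := by fun_prop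
    exact (hsgd.measurable_empRisk.comp i1).sub (hsgd.measurable_empRisk.comp i2)
  -- At v = ξ_T the perturbed parameter is W̃_T; inserting its population risk separates the sample
  -- from the ghost sample.
  have hFξ : (fun ω => F (((M.W M.T ω, M.S ω), M.S' ω), M.ξ M.T ω)) = fun ω =>
      (M.popRisk D (M.Wvirt M.T ω) - M.empRisk (M.Wvirt M.T ω) (M.S ω)) -
        (M.popRisk D (M.Wvirt M.T ω) - M.empRisk (M.Wvirt M.T ω) (M.S' ω)) := by
    funext ω
    rw [M.Wvirt_eq_W_add_ξ' hsgd.one_le_T]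
    simp only [F]
    ring
  obtain ⟨hI, hI'⟩ := hsgd.integral_integral_accCov hpert
    ((hsgd.measurable_W le_rfl).prodMk VirtualSGD.measurable_S_exogenous) hF (by
      rw [hFξ]; exact hS.sub hS')
  rw [hFξ, integral_sub hS hS', hzero, sub_zero] at hI'
  -- The risks at W_T + v are added and subtracted and v is averaged over N(0, Σ_{1:T}). Only the
  -- two sensitivities need to be integrable in v, as the unperturbed risks are constant in v.
  have hdecomp : (fun ω => M.empRisk (M.W M.T ω) (M.S' ω) - M.empRisk (M.W M.T ω) (M.S ω)) =ᵐ[P]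
      fun ω => (M.outputSens (M.S' ω) ω - M.outputSens (M.S ω) ω) +
        ∫ v, F (((M.W M.T ω, M.S ω), M.S' ω), v)
          ∂(multivariateGaussian (0 : Param d) (M.accCov M.T ω)) := by
    filter_upwards [hfin.outputSens_S, hfin.outputSens_S'] with ω h1 h2
    have e : ∀ v, F (((M.W M.T ω, M.S ω), M.S' ω), v) =
        (M.empRisk (M.W M.T ω) (M.S' ω) - M.empRisk (M.W M.T ω) (M.S ω)) -
        ((M.empRisk (M.W M.T ω) (M.S' ω) - M.empRisk (M.W M.T ω + v) (M.S' ω)) -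
          (M.empRisk (M.W M.T ω) (M.S ω) - M.empRisk (M.W M.T ω + v) (M.S ω))) := fun v => by
      simp only [F]; ring
    have h21 : Integrable (fun v =>
        (M.empRisk (M.W M.T ω) (M.S' ω) - M.empRisk (M.W M.T ω + v) (M.S' ω)) -
          (M.empRisk (M.W M.T ω) (M.S ω) - M.empRisk (M.W M.T ω + v) (M.S ω)))
        (multivariateGaussian (0 : Param d) (M.accCov M.T ω)) := h2.sub h1
    simp_rw [e]
    rw [integral_sub (integrable_const _) h21, integral_sub h2 h1]
    simp [VirtualSGD.outputSens]
  refine ⟨(hfin.outputPenalty.add hI).congr hdecomp.symm, ?_⟩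
  rw [VirtualSGD.gen, integral_congr_ae hdecomp, integral_add hfin.outputPenalty hI, hI',
    VirtualSGD.outputPenalty]
  refine (abs_add_le _ _).trans ?_
  rw [add_comm]
  gcongr
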